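/- Let $\mathbb{S}^n$ be the space of real symmetric $n\times n$ matrices with the trace inner product and Frobenius norm, $\mathbb{S}^n_+$ its cone of positive semidefinite matrices, and $\mathbb{Y},\mathbb{W}$ finite-dimensional real Euclidean spaces. Let $\mathcal{A}:\mathbb{S}^n\to\mathbb{Y}$ and $\mathcal{F}:\mathbb{S}^n\to\mathbb{W}$ be linear, $C\in\mathbb{S}^n$, $b\in\mathbb{Y}$, $\mathcal{Q}\subseteq\mathbb{Y}$ a convex polyhedral cone with polar $\mathcal{Q}^\circ$, and $h:\mathbb{W}\to(-\infty,+\infty]$ a function whose domain $\{h<\infty\}$ is non-empty, open and convex, and which is continuously differentiable and strictly convex on it; $h^*$ is its conjugate. Consider the primal problem $$\min\ h(\mathcal{F}X)+\langle C,X\rangle\quad\text{s.t. } b-\mathcal{A}X\in\mathcal{Q}^\circ,\ X\in\mathbb{S}^n_+ \tag{P}$$ and, for $z=(y,w,S)\in\mathbb{Z}:=\mathbb{Y}\times\mathbb{W}\times\mathbb{S}^n$ and $\mathbb{D}:=\mathcal{Q}\times\mathbb{W}\times\mathbb{S}^n_+$, the dual problem $$\min\ \vartheta(z):=-\langle b,y\rangle+h^*(-w)\quad\text{s.t.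 } R(z):=\mathcal{A}^*y+\mathcal{F}^*w+S-C=0,\ z\in\mathbb{D}, \tag{D}$$ with optimal value $\inf\vartheta\in[-\infty,+\infty]$. Let $l(z,X):=\vartheta(z)+\langle X,R(z)\rangle$ for $z\in\mathbb{D}$ and $l(z,X):=+\infty$ for $z\notin\mathbb{D}$, $\psi(z):=\sup_X l(z,X)$, $\phi(X):=\inf_z l(z,X)$, $\mathcal{T}_\psi:=\partial\psi$, $\mathcal{T}_\phi:=-\partial\phi$ (supergradients of the concave function $\phi$), and $\mathcal{T}_l(z,X):=\{(u,v)\mid u\in\partial_z l(z,X),\ -v\in\partial_X l(z,X)\}$ (subgradients in $z$, supergradients in $X$). Products carry the Euclidean product norm, and $\mathrm{dist}(\cdot,\emptyset)=\infty$. A multi-valued mapping $T$ is metrically subregular at $\bar x$ for $0$ with modulus $\kappa$ if $0\in T(\bar x)$ and $\mathrm{dist}(x,T^{-1}(0))\le\kappa\,\mathrm{dist}(0,T(x))$ for all $x$ near $\bar x$. Let $0<c_k\uparrow c_\infty\le\infty$ and $X^0\in\mathbb{S}^n_+$. The augmented Lagrangian method (ALM) for (D) generates, for $k\ge 0$, with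 $\zeta_k(z):=l(z,X^k)+\frac{c_k}{2}\|R(z)\|^2$, a point $z^{k+1}=(y^{k+1},w^{k+1},S^{k+1})$ with $y^{k+1}\in\mathcal{Q}$, $w^{k+1}\in\mathbb{W}$, $S^{k+1}=\Pi_{\mathbb{S}^n_+}(C-\mathcal{A}^*y^{k+1}-\mathcal{F}^*w^{k+1}-c_k^{-1}X^k)$, and $X^{k+1}=X^k+c_kR(z^{k+1})$. The stopping criteria, each required for all $k\ge 0$, are: - $(A')$ $\zeta_k(z^{k+1})-\inf\zeta_k\le\varepsilon_k^2/(2c_k)$, with $\varepsilon_k\ge0$, $\sum_k\varepsilon_k<\infty$; - $(B')$ $\zeta_k(z^{k+1})-\inf\zeta_k\le(\eta_k^2/(2c_k))\|X^{k+1}-X^k\|^2$, with $\eta_k\ge0$, $\sum_k\eta_k<\infty$; - $(B'')$ $\mathrm{dist}(0,\partial\zeta_k(z^{k+1}))\le(\eta_k'/c_k)\|X^{k+1}-X^k\|$, with $0\le\eta_k'\to0$. **Theorem.** If (P) has an optimal solution, then $\mathcal{T}_\phi^{-1}(0)$ is the optimal solution set of (P). Assume that $\Omega:=\mathcal{T}_\phi^{-1}(0)$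 is non-empty and let $\{(z^k,X^k)\}$ be an infinite sequence generated by the ALM with criterion $(A')$. Then $\{X^k\}$ is bounded and converges to some $X^\infty\in\Omega$, and for all $k\ge0$, $z^{k+1}\in\mathbb{D}$, $$\|R(z^{k+1})\|=c_k^{-1}\|X^{k+1}-X^k\|\to0,$$ $$\vartheta(z^{k+1})-\inf\vartheta\le\zeta_k(z^{k+1})-\inf\zeta_k+\tfrac{1}{2c_k}\left(\|X^k\|^2-\|X^{k+1}\|^2\right).$$ If (D) has a non-empty bounded solution set, then $\{z^k\}$ is bounded and all its accumulation points are optimal solutions of (D). (a) Suppose that $\mathcal{T}_\phi$ is metrically subregular at $X^\infty$ for the origin with modulus $\kappa_\phi>0$ and that $(B')$ also holds. Then there is $\bar k$ such that for all $k\ge\bar k$: $\eta_k<1$, $\theta_k<1$, $$\mathrm{dist}(X^{k+1},\Omega)\le\theta_k\,\mathrm{dist}(X^k,\Omega),\quad \|R(z^{k+1})\|\le\tau_k\,\mathrm{dist}(X^k,\Omega),\quad \vartheta(z^{k+1})-\inf\vartheta\le\tau_k'\,\mathrm{dist}(X^k,\Omega),$$ where, with the limits read as $0$ if $c_\infty=\infty$,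 $$\theta_k=\left(\frac{\kappa_\phi}{\sqrt{\kappa_\phi^2+c_k^2}}+2\eta_k\right)(1-\eta_k)^{-1}\to\frac{\kappa_\phi}{\sqrt{\kappa_\phi^2+c_\infty^2}},\qquad \tau_k=c_k^{-1}(1-\eta_k)^{-1}\to\frac1{c_\infty},$$ $$\tau_k'=\tfrac12\tau_k\left(\eta_k^2\|X^{k+1}-X^k\|+\|X^{k+1}\|+\|X^k\|\right)\to\frac{\|X^\infty\|}{c_\infty}.$$ In particular, if $c_\infty=\infty$, then $\mathrm{dist}(X^k,\Omega)\to0$ Q-superlinearly, and $\|R(z^k)\|$ and $\vartheta(z^k)-\inf\vartheta$ are eventually bounded above by sequences that converge to $0$ Q-superlinearly (R-superlinear convergence of the dual feasibility and, from above, of the objective value). (b) Suppose in addition that $(B'')$ holds, that $\mathcal{T}_\psi^{-1}(0)$ is non-empty and bounded, and that there are $\kappa_l\ge0$, $\epsilon>0$ such that for all $(z,X)\in\mathbb{Z}\times\mathbb{S}^n$ with $\mathrm{dist}((z,X),\mathcal{T}_\psi^{-1}(0)\times\{X^\infty\})\le\epsilon$ and $\mathcal{T}_l(z,X)\ne\emptyset$,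 $$\mathrm{dist}((z,X),\mathcal{T}_l^{-1}(0))\le\kappa_l\,\mathrm{dist}(0,\mathcal{T}_l(z,X)).$$ Then there is $\tilde k$ such that for all $k\ge\tilde k$, $\eta_k<1$ and $$\mathrm{dist}(z^{k+1},\mathcal{T}_\psi^{-1}(0))\le\theta_k'\,\mathrm{dist}(X^k,\Omega),\qquad \theta_k'=\kappa_l c_k^{-1}(1+\eta_k')(1-\eta_k)^{-1}\to\frac{\kappa_l}{c_\infty}$$ (limit $0$ if $c_\infty=\infty$). In particular, if $c_\infty=\infty$, then $\mathrm{dist}(z^k,\mathcal{T}_\psi^{-1}(0))\to0$ R-superlinearly. -/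

import Mathlib

open Filter Topology
open scoped InnerProductSpace ENNReal

noncomputable section

/-! ### Symmetric matrices with the trace inner product -/

/-- Real symmetric `n × n` matrices, as a subspace of the Euclidean space of all families of
`n * n` entries; the inherited inner product is `∑ i j, X i j * Y i j = tr (Xᵀ Y)` and the
inherited norm is the Frobenius norm. -/
def symSubmodule (n : ℕ) : Submodule ℝ (EuclideanSpace ℝ (Fin n × Fin n)) where
  carrier := {x | ∀ i j, x (i, j) = x (j, i)}
  add_mem' := by
    intro a b ha hb i j
    simp only [PiLp.add_apply, ha i j, hb i j]
  zero_mem' := by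
    intro i j
    simp
  smul_mem' := by
    intro c a ha i j
    simp only [PiLp.smul_apply, ha i j]

abbrev SymMat (n : ℕ) : Type := symSubmodule n

def SymMat.toMatrix {n : ℕ} (X : SymMat n) : Matrix (Fin n) (Fin n) ℝ :=
  Matrix.of fun i j => (X : EuclideanSpace ℝ (Fin n × Fin n)) (i, j)

/-- The cone of positive semidefinite matrices. -/
def psdCone (n : ℕ) : Set (SymMat n) := {X | X.toMatrix.PosSemidef}

/-! ### Convex analysis -/

section ConvexAnalysis

variable {E G : Type*}

/-- `p` is the metric projection of `x` onto `D`. -/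
def IsMetricProjection [NormedAddCommGroup E] (D : Set E) (x p : E) : Prop :=
  p ∈ D ∧ ∀ d ∈ D, ‖x - p‖ ≤ ‖x - d‖

/-- Convex polyhedral cones: intersections of finitely many closed half-spaces
`{y | ⟪a, y⟫ ≤ 0}`. -/
def IsPolyhedralCone [NormedAddCommGroup E] [InnerProductSpace ℝ E] (Q : Set E) : Prop :=
  ∃ s : Finset E, Q = {y | ∀ a ∈ s, ⟪a, y⟫_ℝ ≤ 0}

/-- The polar cone `Q°`. -/
def polarCone [NormedAddCommGroup E] [InnerProductSpace ℝ E] (Q : Set E) : Set E :=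
  {v | ∀ d ∈ Q, ⟪v, d⟫_ℝ ≤ 0}

/-- The convex conjugate of an extended-real-valued function. -/
def convexConj [NormedAddCommGroup E] [InnerProductSpace ℝ E] (f : E → EReal) (u : E) : EReal :=
  ⨆ x : E, ((⟪x, u⟫_ℝ : ℝ) : EReal) - f x

/-- Subgradients of a convex function at a point where it is finite (empty elsewhere). -/
def subdiff [NormedAddCommGroup E] [InnerProductSpace ℝ E] (f : E → EReal) (x : E) : Set E :=
  {v | f x ≠ ⊤ ∧ f x ≠ ⊥ ∧ ∀ x', f x + ((⟪v, x' - x⟫_ℝ : ℝ) : EReal) ≤ f x'}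

/-- Supergradients of a concave function at a point where it is finite (empty elsewhere). -/
def superdiff [NormedAddCommGroup E] [InnerProductSpace ℝ E] (f : E → EReal) (x : E) : Set E :=
  {v | f x ≠ ⊤ ∧ f x ≠ ⊥ ∧ ∀ x', f x' ≤ f x + ((⟪v, x' - x⟫_ℝ : ℝ) : EReal)}

/-- The inverse image `F⁻¹(y)` of a point under a multi-valued mapping. -/
def mvInv (F : E → Set G) (y : G) : Set E := {x | y ∈ F x}

/-- Metric subregularity of `F` at `x₀` for `y₀` with modulus `κ`. The distance to the empty set
is `∞`, so the inequality is void where `F x` is empty. -/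
def MetricallySubregular [PseudoEMetricSpace E] [PseudoEMetricSpace G]
    (F : E → Set G) (x₀ : E) (y₀ : G) (κ : ℝ) : Prop :=
  y₀ ∈ F x₀ ∧ ∃ U ∈ 𝓝 x₀, ∀ x ∈ U, (F x).Nonempty →
    Metric.infEDist x (mvInv F y₀) ≤ ENNReal.ofReal κ * Metric.infEDist y₀ (F x)

end ConvexAnalysis

/-- Q-superlinear convergence to `0` of a nonnegative sequence. -/
def QSuperlinear (a : ℕ → ℝ) : Prop :=
  (∀ k, 0 ≤ a k) ∧ Tendsto a atTop (𝓝 0) ∧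
    ∃ θ : ℕ → ℝ, Tendsto θ atTop (𝓝 0) ∧ ∀ᶠ k in atTop, a (k + 1) ≤ θ k * a k

/-- `f` is eventually bounded above by a sequence that converges to `0` Q-superlinearly. For
nonnegative `f` this is R-superlinear convergence to `0`. -/
def RSuperlinear (f : ℕ → EReal) : Prop :=
  ∃ a : ℕ → ℝ, QSuperlinear a ∧ ∀ᶠ k in atTop, f k ≤ (a k : EReal)

/-! ### The pair of problems -/

/-- The space of the dual variables `z = (y, w, S)`, with the Euclidean product norm. -/
abbrev DualVar (n : ℕ) (Y W : Type*) : Type _ := WithLp 2 (Y × WithLp 2 (W × SymMat n))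

/-- The data of the problem
`min h(F X) + ⟨C, X⟩  subject to  b - A X ∈ Q°, X positive semidefinite`. -/
structure SDPData (n : ℕ) (Y W : Type*)
    [NormedAddCommGroup Y] [InnerProductSpace ℝ Y] [FiniteDimensional ℝ Y]
    [NormedAddCommGroup W] [InnerProductSpace ℝ W] [FiniteDimensional ℝ W] where
  A : SymMat n →ₗ[ℝ] Y
  F : SymMat n →ₗ[ℝ] W
  C : SymMat n
  b : Y
  Q : Set Y
  h : W → EReal

namespace SDPData

variable {n : ℕ} {Y W : Type*}
  [NormedAddCommGroup Y] [InnerProductSpace ℝ Y] [FiniteDimensional ℝ Y]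
  [NormedAddCommGroup W] [InnerProductSpace ℝ W] [FiniteDimensional ℝ W]

def domh (P : SDPData n Y W) : Set W := {w | P.h w < ⊤}

/-- The standing assumptions: `Q` is a convex polyhedral cone, and `h : W → (-∞, +∞]` is
continuously differentiable and strictly convex on its domain, a nonempty open convex set. -/
structure Standing (P : SDPData n Y W) : Prop where
  polyhedral : IsPolyhedralCone P.Q
  h_ne_bot : ∀ w, P.h w ≠ ⊥
  dom_nonempty : P.domh.Nonempty
  dom_open : IsOpen P.domh
  contDiffOn : ContDiffOn ℝ 1 (fun w => (P.h w).toReal) P.domh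
  strictConvexOn : StrictConvexOn ℝ P.domh (fun w => (P.h w).toReal)

/-- The primal objective `h(F X) + ⟨C, X⟩`. -/
def primalObj (P : SDPData n Y W) (X : SymMat n) : EReal :=
  P.h (P.F X) + ((⟪P.C, X⟫_ℝ : ℝ) : EReal)

def primalFeasible (P : SDPData n Y W) : Set (SymMat n) :=
  {X | X ∈ psdCone n ∧ P.b - P.A X ∈ polarCone P.Q}

/-- The optimal solutions of the primal problem. -/
def primalSol (P : SDPData n Y W) : Set (SymMat n) :=
  {X | X ∈ P.primalFeasible ∧ P.primalObj X < ⊤ ∧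
    ∀ X' ∈ P.primalFeasible, P.primalObj X ≤ P.primalObj X'}

/-- `𝔻 = Q × W × 𝕊₊`. -/
def dualSet (P : SDPData n Y W) : Set (DualVar n Y W) :=
  {z | z.fst ∈ P.Q ∧ z.snd.snd ∈ psdCone n}

/-- The residual `A* y + F* w + S - C` of the linear constraint of the dual problem. -/
def residual (P : SDPData n Y W) (z : DualVar n Y W) : SymMat n :=
  LinearMap.adjoint P.A z.fst + LinearMap.adjoint P.F z.snd.fst + z.snd.snd - P.C

/-- The dual objective `ϑ(z) = -⟨b, y⟩ + h*(-w)`. -/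
def dualObj (P : SDPData n Y W) (z : DualVar n Y W) : EReal :=
  ((-⟪P.b, z.fst⟫_ℝ : ℝ) : EReal) + convexConj P.h (-z.snd.fst)

def dualFeasible (P : SDPData n Y W) : Set (DualVar n Y W) :=
  {z | z ∈ P.dualSet ∧ P.residual z = 0}

/-- The optimal value `inf ϑ` of the dual problem (`⊤` if it is infeasible). -/
def dualVal (P : SDPData n Y W) : EReal := ⨅ z ∈ P.dualFeasible, P.dualObj z

/-- The optimal solutions of the dual problem. -/
def dualSol (P : SDPData n Y W) : Set (DualVar n Y W) :=
  {z | z ∈ P.dualFeasible ∧ P.dualObj z < ⊤ ∧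
    ∀ z' ∈ P.dualFeasible, P.dualObj z ≤ P.dualObj z'}

open Classical in
/-- The Lagrangian function of the dual problem, equal to `⊤` off `𝔻`. -/
def lagr (P : SDPData n Y W) (z : DualVar n Y W) (X : SymMat n) : EReal :=
  if z ∈ P.dualSet then P.dualObj z + ((⟪X, P.residual z⟫_ℝ : ℝ) : EReal) else ⊤

def psi (P : SDPData n Y W) (z : DualVar n Y W) : EReal := ⨆ X, P.lagr z X

def phi (P : SDPData n Y W) (X : SymMat n) : EReal := ⨅ z, P.lagr z X

/-- `T_ψ = ∂ψ`. -/
def Tpsi (P : SDPData n Y W) (z : DualVar n Y W) : Set (DualVar n Y W) := subdiff P.psi z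

/-- `T_φ = -∂φ`, where `∂φ` consists of the supergradients of the concave function `φ`. -/
def Tphi (P : SDPData n Y W) (X : SymMat n) : Set (SymMat n) := {v | -v ∈ superdiff P.phi X}

/-- `T_l(z, X) = {(u, v) | (u, -v) ∈ ∂l(z, X)}` for the convex-concave function `l`: `u` is a
subgradient of `l(·, X)` at `z` and `-v` is a supergradient of `l(z, ·)` at `X`. -/
def Tl (P : SDPData n Y W) (p : WithLp 2 (DualVar n Y W × SymMat n)) :
    Set (WithLp 2 (DualVar n Y W × SymMat n)) :=
  {q | q.fst ∈ subdiff (fun z => P.lagr z p.snd) p.fst ∧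
    -q.snd ∈ superdiff (fun X => P.lagr p.fst X) p.snd}

/-- The augmented Lagrangian function `L_c(z, X)`, equal to `⊤` for `z` off `𝔻`. -/
def augLagr (P : SDPData n Y W) (c : ℝ) (z : DualVar n Y W) (X : SymMat n) : EReal :=
  P.lagr z X + ((c / 2 * ‖P.residual z‖ ^ 2 : ℝ) : EReal)

/-! ### The augmented Lagrangian method -/

/-- `ζ_k(z) = L_{c_k}(z, X^k)`. -/
def zeta (P : SDPData n Y W) (c : ℕ → ℝ) (X : ℕ → SymMat n) (k : ℕ) (z : DualVar n Y W) : EReal :=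
  P.augLagr (c k) z (X k)

def infZeta (P : SDPData n Y W) (c : ℕ → ℝ) (X : ℕ → SymMat n) (k : ℕ) : EReal :=
  ⨅ z ∈ P.dualSet, P.zeta c X k z

/-- The iteration of the augmented Lagrangian method with penalty parameters `c k`; how well
`(y^{k+1}, w^{k+1})` has to minimize `ζ_k` is the matter of the stopping criteria. The entry
`z 0` is irrelevant. -/
structure IsALM (P : SDPData n Y W) (c : ℕ → ℝ) (z : ℕ → DualVar n Y W)
    (X : ℕ → SymMat n) : Prop where
  start : X 0 ∈ psdCone n
  y_mem : ∀ k, (z (k + 1)).fst ∈ P.Q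
  S_eq : ∀ k, IsMetricProjection (psdCone n)
    (P.C - LinearMap.adjoint P.A (z (k + 1)).fst - LinearMap.adjoint P.F (z (k + 1)).snd.fst
      - (c k)⁻¹ • X k) (z (k + 1)).snd.snd
  X_eq : ∀ k, X (k + 1) = X k + c k • P.residual (z (k + 1))

/-- Criterion (A'): `ζ_k(z^{k+1}) - inf ζ_k ≤ ε_k² / (2 c_k)`, `ε_k ≥ 0`, `∑ ε_k < ∞`. -/
structure CritA (P : SDPData n Y W) (c : ℕ → ℝ) (z : ℕ → DualVar n Y W) (X : ℕ → SymMat n)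
    (ε : ℕ → ℝ) : Prop where
  nonneg : ∀ k, 0 ≤ ε k
  summable : Summable ε
  le : ∀ k, P.zeta c X k (z (k + 1)) ≤
    P.infZeta c X k + ((ε k ^ 2 / (2 * c k) : ℝ) : EReal)

/-- Criterion (B'): `ζ_k(z^{k+1}) - inf ζ_k ≤ (η_k² / (2 c_k)) ‖X^{k+1} - X^k‖²`, `η_k ≥ 0`,
`∑ η_k < ∞`. -/
structure CritB (P : SDPData n Y W) (c : ℕ → ℝ) (z : ℕ → DualVar n Y W) (X : ℕ → SymMat n)
    (η : ℕ → ℝ) : Prop where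
  nonneg : ∀ k, 0 ≤ η k
  summable : Summable η
  le : ∀ k, P.zeta c X k (z (k + 1)) ≤
    P.infZeta c X k + ((η k ^ 2 / (2 * c k) * ‖X (k + 1) - X k‖ ^ 2 : ℝ) : EReal)

/-- Criterion (B''): `dist(0, ∂ζ_k(z^{k+1})) ≤ (η'_k / c_k) ‖X^{k+1} - X^k‖`,
`0 ≤ η'_k → 0`. -/
structure CritB' (P : SDPData n Y W) (c : ℕ → ℝ) (z : ℕ → DualVar n Y W) (X : ℕ → SymMat n)
    (η' : ℕ → ℝ) : Prop where
  nonneg : ∀ k, 0 ≤ η' k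
  tendsto : Tendsto η' atTop (𝓝 0)
  le : ∀ k, Metric.infEDist 0 (subdiff (P.zeta c X k) (z (k + 1))) ≤
    ENNReal.ofReal (η' k / c k * ‖X (k + 1) - X k‖)

end SDPData

/-! ### The rate constants -/

/-- `1 / c_∞`, read as `0` if `c_∞ = ∞`. -/
def recipLim (cInf : EReal) : ℝ := if cInf = ⊤ then 0 else 1 / cInf.toReal

/-- `κ / √(κ² + c_∞²)`, read as `0` if `c_∞ = ∞`. -/
def thetaLim (κ : ℝ) (cInf : EReal) : ℝ :=
  if cInf = ⊤ then 0 else κ / √(κ ^ 2 + cInf.toReal ^ 2)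

/-- `θ_k` for `c = c_k`, `η = η_k`. -/
def thetaRate (κ c η : ℝ) : ℝ := (κ / √(κ ^ 2 + c ^ 2) + 2 * η) * (1 - η)⁻¹

/-- `τ_k` for `c = c_k`, `η = η_k`. -/
def tauRate (c η : ℝ) : ℝ := c⁻¹ * (1 - η)⁻¹

/-- `τ'_k` for `c = c_k`, `η = η_k`, `X = X^k`, `X' = X^{k+1}`. -/
def tauRate' {n : ℕ} (c η : ℝ) (X X' : SymMat n) : ℝ :=
  tauRate c η * (η ^ 2 * ‖X' - X‖ + ‖X'‖ + ‖X‖) / 2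

/-- `θ'_k` for `c = c_k`, `η = η_k`, `η' = η'_k`. -/
def thetaRate' (κ c η η' : ℝ) : ℝ := κ * c⁻¹ * (1 + η') * (1 - η)⁻¹

end

/-! The augmented Lagrangian method for (D) is an inexact proximal point method for maximizing the
concave dual function φ, and everything rests on making this precise for one step. The penalty is
strongly convex in the residual, so along any minimizing sequence of ζ the residuals converge to
some u, even if ζ has no minimizer. The point p = X + c u is then the exact proximal point, with -u
∈ T_φ(p), and an approximate minimizer of gap G yields a multiplier X' with ‖X' - p‖² ≤ 2cG
(`exists_prox`, `exists_isProx`, `exists_proxStep`).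

Convergence follows from ‖p - X̄‖² + ‖p - X‖² ≤ ‖X - X̄‖² for X̄ ∈ Ω: with summable errors the
sequence is quasi-Fejér monotone, and closedness of the graph of T_φ at 0 puts its limit in Ω. Since
ζ coincides with ϑ on feasible points, inf ζ ≤ inf ϑ, which gives the bound on the objective. A
convexity argument (`isBounded_range_of_minimizing`) then gives boundedness of the dual iterates.

For (a), subregularity applied at p gives dist(p, Ω) ≤ (κ/c)‖p - X‖. Together with the inequality
above, passed to the infimum over Ω, this is the factor κ/√(κ² + c²); criterion (B') makes the error
‖X' - p‖ relative to the step length. For (b), the gradient of the penalty is absorbed by the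
multiplier update: subgradients of ζ_k at z^{k+1} are subgradients of l(·, X^{k+1}). Hence (B'')
bounds dist(0, T_l), and the zeros of T_l are saddle points, whose first components minimize ψ.

On the primal side, φ is minus the primal objective at feasible X with F X ∈ dom h, and a finite
value of φ forces feasibility. But φ may be finite where h(F X) = ∞; that no maximizer lies there
when (P) is solvable uses openness of dom h and strict convexity of h. -/

noncomputable section

/-! ### The proximal point of the dual function -/

section Prox

variable {E H : Type*} [AddCommGroup E] [Module ℝ E]
  [NormedAddCommGroup H] [InnerProductSpace ℝ H]

/-- Divide by t and let t → 0. This turns an inequality along a segment with a second-order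
remainder into a first-order condition. -/
theorem nonpos_of_forall_mul_le_sq_mul {a K : ℝ}
    (h : ∀ t : ℝ, 0 < t → t ≤ 1 → t * a ≤ t ^ 2 * K) : a ≤ 0 := by
  by_contra! ha
  have hK : 0 < |K| + 1 := by positivity
  set t := min 1 (a / (2 * (|K| + 1))) with ht
  have ht0 : 0 < t := lt_min one_pos (by positivity)
  have h1 := h t ht0 (min_le_left _ _)
  have h2 : t ≤ a / (2 * (|K| + 1)) := min_le_right _ _
  rw [le_div_iff₀ (by positivity)] at h2
  have h3 : a ≤ t * K := by
    have : t * a ≤ t * (t * K) := by nlinarith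
    exact le_of_mul_le_mul_left this ht0
  nlinarith [le_abs_self K]

theorem norm_add_smul_sq (u v : H) (t : ℝ) :
    ‖u + t • v‖ ^ 2 = ‖u‖ ^ 2 + 2 * t * ⟪u, v⟫_ℝ + t ^ 2 * ‖v‖ ^ 2 := by
  rw [norm_add_sq_real, norm_smul, real_inner_smul_right, mul_pow, Real.norm_eq_abs, sq_abs]
  ring

theorem affineMap_segment (R : E →ᵃ[ℝ] H) (z z' : E) (t : ℝ) :
    R (z + t • (z' - z)) = R z + t • (R z' - R z) := by
  have := R.apply_lineMap z z' t
  simp only [AffineMap.lineMap_apply, vsub_eq_sub, vadd_eq_add] at this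
  rw [add_comm z, this, add_comm]

/-- Existence of the proximal point `X + c u` of the concave function `inf_z g z + ⟪·, R z⟫`,
together with strong duality for the augmented Lagrangian function. -/
theorem exists_prox [CompleteSpace H] {D : Set E} {g : E → ℝ} (hg : ConvexOn ℝ D g)
    (hD : D.Nonempty) (R : E →ᵃ[ℝ] H) {Xb : H} {m : ℝ}
    (hm : ∀ z ∈ D, m ≤ g z + ⟪Xb, R z⟫_ℝ) (X : H) {c : ℝ} (hc : 0 < c) :
    ∃ (γ : ℝ) (u : H),
      IsGLB ((fun z => g z + ⟪X, R z⟫_ℝ + c / 2 * ‖R z‖ ^ 2) '' D) γ ∧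
      (∀ z ∈ D, γ + c / 2 * ‖u‖ ^ 2 ≤ g z + ⟪X + c • u, R z⟫_ℝ) ∧
      ∀ (X' : H) (a : ℝ), (∀ z ∈ D, a ≤ g z + ⟪X', R z⟫_ℝ) →
        a ≤ γ + c / 2 * ‖u‖ ^ 2 + ⟪u, X' - (X + c • u)⟫_ℝ := by
  set J : E → ℝ := fun z => g z + ⟪X, R z⟫_ℝ + c / 2 * ‖R z‖ ^ 2 with hJ
  have hbdd : BddBelow (J '' D) := by
    -- Completing the square: this is m plus the minimum over r of ⟪X - Xb, r⟫ + (c/2)‖r‖².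
    refine ⟨m - ‖X - Xb‖ ^ 2 / (2 * c), ?_⟩
    rintro _ ⟨z, hz, rfl⟩
    have h1 := hm z hz
    have h2 : (0 : ℝ) ≤ ‖(X - Xb) + c • R z‖ ^ 2 := by positivity
    rw [norm_add_smul_sq, inner_sub_left] at h2
    have h3 : 0 ≤ (‖X - Xb‖ ^ 2 + 2 * c * (⟪X, R z⟫_ℝ - ⟪Xb, R z⟫_ℝ) + c ^ 2 * ‖R z‖ ^ 2)
        / (2 * c) := by positivity
    have h4 : (‖X - Xb‖ ^ 2 + 2 * c * (⟪X, R z⟫_ℝ - ⟪Xb, R z⟫_ℝ) + c ^ 2 * ‖R z‖ ^ 2) / (2 * c)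
        = ‖X - Xb‖ ^ 2 / (2 * c) + (⟪X, R z⟫_ℝ - ⟪Xb, R z⟫_ℝ) + c / 2 * ‖R z‖ ^ 2 := by
      field_simp
    rw [h4] at h3
    simp only [hJ]
    linarith
  have hne : (J '' D).Nonempty := hD.image J
  set γ := sInf (J '' D) with hγ
  have hglb : IsGLB (J '' D) γ := isGLB_csInf hne hbdd
  have hle : ∀ z ∈ D, γ ≤ J z := fun z hz => hglb.1 ⟨z, hz, rfl⟩
  have hseg : ∀ z ∈ D, ∀ z' ∈ D, ∀ t : ℝ, 0 ≤ t → t ≤ 1 →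
      γ ≤ (1 - t) * g z + t * g z' + ⟪X, R z⟫_ℝ + t * ⟪X, R z' - R z⟫_ℝ +
        c / 2 * (‖R z‖ ^ 2 + 2 * t * ⟪R z, R z' - R z⟫_ℝ + t ^ 2 * ‖R z' - R z‖ ^ 2) := by
    intro z hz z' hz' t ht0 ht1
    have e : (1 - t) • z + t • z' = z + t • (z' - z) := by module
    have hmem : z + t • (z' - z) ∈ D := e ▸ hg.1 hz hz' (by linarith) ht0 (by ring)
    have h1 := hle _ hmem
    have h2 := hg.2 hz hz' (sub_nonneg.2 ht1) ht0 (by ring)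
    rw [e] at h2
    simp only [hJ, affineMap_segment, norm_add_smul_sq, inner_add_right,
      real_inner_smul_right] at h1
    simp only [smul_eq_mul] at h2
    linarith
  obtain ⟨a, -, ha, haD⟩ := exists_seq_tendsto_sInf hne hbdd
  choose ζ hζD hζ using haD
  have hJlim : Tendsto (fun j => J (ζ j)) atTop (𝓝 γ) := by simpa only [hζ] using ha
  -- At the midpoint of two almost minimizers the penalty falls below its average by (c/8)‖R (ζ j) -
  -- R (ζ i)‖². So the residuals are Cauchy, although ζ itself need not converge.
  have hmid : ∀ i j, c / 4 * ‖R (ζ j) - R (ζ i)‖ ^ 2 ≤ (J (ζ i) - γ) + (J (ζ j) - γ) := by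
    intro i j
    have h1 := hseg _ (hζD i) _ (hζD j) (1 / 2) (by norm_num) (by norm_num)
    have h2 := norm_sub_sq_real (R (ζ j)) (R (ζ i))
    have h3 : ⟪R (ζ i), R (ζ j) - R (ζ i)⟫_ℝ = ⟪R (ζ j), R (ζ i)⟫_ℝ - ‖R (ζ i)‖ ^ 2 := by
      rw [inner_sub_right, real_inner_self_eq_norm_sq, real_inner_comm]
    rw [h3, inner_sub_right] at h1
    have h4 : ⟪R (ζ j), R (ζ i)⟫_ℝ
        = (‖R (ζ j)‖ ^ 2 + ‖R (ζ i)‖ ^ 2 - ‖R (ζ j) - R (ζ i)‖ ^ 2) / 2 := by linarith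
    rw [h4] at h1
    simp only [hJ]
    linarith
  have hcauchy : CauchySeq fun j => R (ζ j) := by
    rw [Metric.cauchySeq_iff]
    intro e he
    have hev : ∀ᶠ j in atTop, J (ζ j) < γ + c / 8 * e ^ 2 :=
      hJlim.eventually_lt_const (by have : 0 < c / 8 * e ^ 2 := by positivity
                                    linarith)
    obtain ⟨N, hN⟩ := eventually_atTop.1 hev
    refine ⟨N, fun i hi j hj => ?_⟩
    have h1 := hmid j i
    have h2 := hN i hi
    have h3 := hN j hj
    rw [dist_eq_norm]
    refine lt_of_pow_lt_pow_left₀ 2 he.le ?_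
    have h4 : c / 4 * ‖R (ζ i) - R (ζ j)‖ ^ 2 < c / 4 * e ^ 2 := by linarith
    exact lt_of_mul_lt_mul_left h4 (by positivity)
  obtain ⟨u, hu⟩ := cauchySeq_tendsto_of_complete hcauchy
  have hglim : Tendsto (fun j => g (ζ j)) atTop (𝓝 (γ - ⟪X, u⟫_ℝ - c / 2 * ‖u‖ ^ 2)) := by
    have : (fun j => g (ζ j)) = fun j => J (ζ j) - ⟪X, R (ζ j)⟫_ℝ - c / 2 * ‖R (ζ j)‖ ^ 2 := by
      funext j; simp only [hJ]; ring
    rw [this]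
    exact (hJlim.sub (tendsto_const_nhds.inner hu)).sub ((hu.norm.pow 2).const_mul _)
  refine ⟨γ, u, hglb, fun z hz => ?_, fun X' b hb => ?_⟩
  -- First-order optimality of a possibly unattained minimum: `hseg` from ζ j towards z, with j → ∞
  -- at fixed t.
  · have key : ∀ t : ℝ, 0 < t → t ≤ 1 →
        t * (γ + c / 2 * ‖u‖ ^ 2 - (g z + ⟪X + c • u, R z⟫_ℝ)) ≤
          t ^ 2 * (c / 2 * ‖R z - u‖ ^ 2) := by
      intro t ht0 ht1
      have hlim : Tendsto (fun j => (1 - t) * g (ζ j) + t * g z + ⟪X, R (ζ j)⟫_ℝ +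
          t * ⟪X, R z - R (ζ j)⟫_ℝ + c / 2 * (‖R (ζ j)‖ ^ 2 +
            2 * t * ⟪R (ζ j), R z - R (ζ j)⟫_ℝ + t ^ 2 * ‖R z - R (ζ j)‖ ^ 2)) atTop
          (𝓝 ((1 - t) * (γ - ⟪X, u⟫_ℝ - c / 2 * ‖u‖ ^ 2) + t * g z + ⟪X, u⟫_ℝ +
          t * ⟪X, R z - u⟫_ℝ + c / 2 * (‖u‖ ^ 2 +
            2 * t * ⟪u, R z - u⟫_ℝ + t ^ 2 * ‖R z - u‖ ^ 2))) := by
        have hs := tendsto_const_nhds (x := R z).sub hu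
        exact ((((hglim.const_mul _).add_const _).add (tendsto_const_nhds.inner hu)).add
          ((tendsto_const_nhds.inner hs).const_mul _)).add
          ((((hu.norm.pow 2).add ((hu.inner hs).const_mul _)).add
            ((hs.norm.pow 2).const_mul _)).const_mul _)
      have h1 := ge_of_tendsto' hlim fun j => hseg _ (hζD j) z hz t ht0.le ht1
      rw [inner_sub_right, inner_sub_right, real_inner_self_eq_norm_sq] at h1
      rw [inner_add_left, real_inner_smul_left]
      linarith
    have := nonpos_of_forall_mul_le_sq_mul key
    linarith
  -- The lower bound b, tested along ζ, passes to the limit; the resulting bound is affine in X'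
  -- with slope u.
  · have hlim : Tendsto (fun j => g (ζ j) + ⟪X', R (ζ j)⟫_ℝ) atTop
        (𝓝 (γ - ⟪X, u⟫_ℝ - c / 2 * ‖u‖ ^ 2 + ⟪X', u⟫_ℝ)) :=
      hglim.add (tendsto_const_nhds.inner hu)
    have h1 := ge_of_tendsto' hlim fun j => hb _ (hζD j)
    rw [inner_sub_right, inner_add_right, real_inner_smul_right, real_inner_self_eq_norm_sq,
      real_inner_comm, real_inner_comm X]
    linarith

end Prox

/-! ### Quasi-Fejér monotone sequences -/

section Fejer

/-- Subtracting the partial sums of ε leaves an antitone sequence bounded below. -/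
theorem tendsto_of_le_add_summable {a ε : ℕ → ℝ} (ha : ∀ k, 0 ≤ a k) (hε : ∀ k, 0 ≤ ε k)
    (hs : Summable ε) (h : ∀ k, a (k + 1) ≤ a k + ε k) : ∃ l, Tendsto a atTop (𝓝 l) := by
  set b : ℕ → ℝ := fun k => a k - ∑ i ∈ Finset.range k, ε i with hb
  have hanti : Antitone b := antitone_nat_of_succ_le fun k => by
    simp only [hb, Finset.sum_range_succ]
    linarith [h k]
  have hbdd : BddBelow (Set.range b) := by
    refine ⟨-∑' i, ε i, ?_⟩
    rintro _ ⟨k, rfl⟩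
    have := hs.sum_le_tsum (Finset.range k) fun i _ => hε i
    simp only [hb]
    linarith [ha k]
  have h1 := (tendsto_atTop_ciInf hanti hbdd).add hs.hasSum.tendsto_sum_nat
  refine ⟨_, h1.congr fun k => ?_⟩
  simp [hb]

variable {H : Type*} [NormedAddCommGroup H]

/-- Convergence of an inexact proximal point iteration: `p k` is the exact step from `x k`. -/
theorem exists_tendsto_of_inexact_prox [ProperSpace H] {Ω : Set H} (hΩ : Ω.Nonempty)
    {x p : ℕ → H} {ε : ℕ → ℝ} (hε : ∀ k, 0 ≤ ε k) (hs : Summable ε)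
    (hp : ∀ k, ∀ y ∈ Ω, ‖p k - y‖ ^ 2 + ‖p k - x k‖ ^ 2 ≤ ‖x k - y‖ ^ 2)
    (hx : ∀ k, ‖x (k + 1) - p k‖ ≤ ε k)
    (hcl : ∀ (σ : ℕ → ℕ) (y : H), StrictMono σ → Tendsto (fun k => p k - x k) atTop (𝓝 0) →
      Tendsto (p ∘ σ) atTop (𝓝 y) → y ∈ Ω) :
    Tendsto (fun k => p k - x k) atTop (𝓝 0) ∧ ∃ y ∈ Ω, Tendsto x atTop (𝓝 y) := by
  have hpn : ∀ k, ∀ y ∈ Ω, ‖p k - y‖ ≤ ‖x k - y‖ := fun k y hy => by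
    have := hp k y hy
    exact le_of_sq_le_sq (by nlinarith [sq_nonneg ‖p k - x k‖]) (norm_nonneg _)
  have hstep : ∀ k, ∀ y ∈ Ω, ‖x (k + 1) - y‖ ≤ ‖p k - y‖ + ε k := fun k y hy => by
    have h1 : x (k + 1) - y = (x (k + 1) - p k) + (p k - y) := by abel
    rw [h1]
    linarith [norm_add_le (x (k + 1) - p k) (p k - y), hx k]
  have hconv : ∀ y ∈ Ω, ∃ l, Tendsto (fun k => ‖x k - y‖) atTop (𝓝 l) := fun y hy =>
    tendsto_of_le_add_summable (fun _ => norm_nonneg _) hε hs fun k =>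
      (hstep k y hy).trans (by linarith [hpn k y hy])
  have hε0 : Tendsto ε atTop (𝓝 0) := hs.tendsto_atTop_zero
  obtain ⟨y₀, hy₀⟩ := hΩ
  obtain ⟨l, hl⟩ := hconv y₀ hy₀
  -- Squeezed between ‖x (k+1) - y₀‖ - ε k and ‖x k - y₀‖. With equal limits, `hp` forces p k - x k
  -- → 0.
  have hpl : Tendsto (fun k => ‖p k - y₀‖) atTop (𝓝 l) := by
    refine tendsto_of_tendsto_of_tendsto_of_le_of_le
      (by simpa using ((tendsto_add_atTop_iff_nat 1).2 hl).sub hε0) hl (fun k => ?_)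
      fun k => hpn k y₀ hy₀
    have := hstep k y₀ hy₀
    simp only
    linarith
  have hd : Tendsto (fun k => p k - x k) atTop (𝓝 0) := by
    rw [tendsto_zero_iff_norm_tendsto_zero]
    have h2 : Tendsto (fun k => ‖p k - x k‖ ^ 2) atTop (𝓝 0) := by
      refine squeeze_zero (fun _ => by positivity) (fun k => ?_)
        (g := fun k => ‖x k - y₀‖ ^ 2 - ‖p k - y₀‖ ^ 2) ?_
      · linarith [hp k y₀ hy₀]
      · simpa using (hl.pow 2).sub (hpl.pow 2)
    have h3 := h2.sqrt
    simpa using h3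
  refine ⟨hd, ?_⟩
  have hbd : Bornology.IsBounded (Set.range x) := by
    obtain ⟨M, hM⟩ := hl.bddAbove_range
    refine (Metric.isBounded_closedBall (x := y₀) (r := M)).subset ?_
    rintro _ ⟨k, rfl⟩
    rw [Metric.mem_closedBall, dist_eq_norm]
    exact hM ⟨k, rfl⟩
  obtain ⟨y, -, σ, hσ, hy⟩ := tendsto_subseq_of_bounded hbd fun k => Set.mem_range_self k
  have hyp : Tendsto (p ∘ σ) atTop (𝓝 y) := by
    have := (hd.comp hσ.tendsto_atTop).add hy
    simpa [Function.comp_def] using this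
  have hyΩ := hcl σ y hσ hd hyp
  -- The distances to y converge because y ∈ Ω, and tend to 0 along a subsequence; hence the whole
  -- sequence converges to y.
  obtain ⟨l', hl'⟩ := hconv y hyΩ
  have h0 : Tendsto (fun k => ‖x (σ k) - y‖) atTop (𝓝 0) :=
    tendsto_iff_norm_sub_tendsto_zero.1 hy
  have : l' = 0 := tendsto_nhds_unique (hl'.comp hσ.tendsto_atTop) h0
  exact ⟨y, hyΩ, tendsto_iff_norm_sub_tendsto_zero.2 (this ▸ hl')⟩

end Fejer

/-! ### The positive semidefinite cone -/

section PSD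

variable {n : ℕ}

theorem SymMat.inner_eq_sum (X S : SymMat n) :
    ⟪X, S⟫_ℝ = ∑ i, ∑ j, X.toMatrix i j * S.toMatrix i j := by
  rw [Submodule.coe_inner, PiLp.inner_apply, Fintype.sum_prod_type]
  refine Finset.sum_congr rfl fun i _ => Finset.sum_congr rfl fun j _ => ?_
  simp [SymMat.toMatrix, mul_comm]

/-- The rank one matrix `v vᵀ`. -/
def SymMat.outer (v : Fin n → ℝ) : SymMat n :=
  ⟨WithLp.toLp 2 fun p => v p.1 * v p.2, fun i j => mul_comm (v i) (v j)⟩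

theorem SymMat.outer_apply (v : Fin n → ℝ) (i j : Fin n) :
    (SymMat.outer v).toMatrix i j = v i * v j := rfl

theorem SymMat.toMatrix_isHermitian (X : SymMat n) : X.toMatrix.IsHermitian := by
  ext i j
  simpa [SymMat.toMatrix] using X.2 j i

/-- The quadratic form vᵀXv is the inner product with vvᵀ, so the cone is an intersection of
half-spaces. -/
theorem mem_psdCone_iff {X : SymMat n} :
    X ∈ psdCone n ↔ ∀ v : Fin n → ℝ, 0 ≤ ⟪X, SymMat.outer v⟫_ℝ := by
  have h : ∀ v : Fin n → ℝ, ⟪X, SymMat.outer v⟫_ℝ = star v ⬝ᵥ (X.toMatrix.mulVec v) := by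
    intro v
    simp only [SymMat.inner_eq_sum, SymMat.outer_apply, dotProduct, Matrix.mulVec, Finset.mul_sum,
      star_trivial]
    exact Finset.sum_congr rfl fun i _ => Finset.sum_congr rfl fun j _ => by ring
  simp only [h]
  exact ⟨fun hX v => (Matrix.posSemidef_iff_dotProduct_mulVec.1 hX).2 v,
    fun hX => Matrix.posSemidef_iff_dotProduct_mulVec.2 ⟨X.toMatrix_isHermitian, hX⟩⟩

theorem isClosed_psdCone : IsClosed (psdCone n) := by
  have : psdCone n = ⋂ v : Fin n → ℝ, {X : SymMat n | 0 ≤ ⟪X, SymMat.outer v⟫_ℝ} := by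
    ext X
    simp [mem_psdCone_iff]
  rw [this]
  exact isClosed_iInter fun v => isClosed_le continuous_const (by fun_prop)

theorem zero_mem_psdCone : (0 : SymMat n) ∈ psdCone n := mem_psdCone_iff.2 fun v => by simp

theorem smul_mem_psdCone {X : SymMat n} (hX : X ∈ psdCone n) {t : ℝ} (ht : 0 ≤ t) :
    t • X ∈ psdCone n := mem_psdCone_iff.2 fun v => by
  have h : ⟪t • X, SymMat.outer v⟫_ℝ = t * ⟪X, SymMat.outer v⟫_ℝ :=
    real_inner_smul_left (F := SymMat n) X (SymMat.outer v) t
  rw [h]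
  exact mul_nonneg ht (mem_psdCone_iff.1 hX v)

theorem add_mem_psdCone {X S : SymMat n} (hX : X ∈ psdCone n) (hS : S ∈ psdCone n) :
    X + S ∈ psdCone n := mem_psdCone_iff.2 fun v => by
  rw [inner_add_left]
  exact add_nonneg (mem_psdCone_iff.1 hX v) (mem_psdCone_iff.1 hS v)

theorem outer_mem_psdCone (v : Fin n → ℝ) : SymMat.outer v ∈ psdCone n :=
  mem_psdCone_iff.2 fun u => by
    have : ⟪SymMat.outer v, SymMat.outer u⟫_ℝ = (∑ i, v i * u i) ^ 2 := by
      simp only [SymMat.inner_eq_sum, SymMat.outer_apply, sq, Finset.sum_mul_sum]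
      exact Finset.sum_congr rfl fun i _ => Finset.sum_congr rfl fun j _ => by ring
    rw [this]
    positivity

/-- Writing S = BᵀB makes S the sum of the rank one matrices of the rows of B. -/
theorem inner_nonneg_of_mem_psdCone {X S : SymMat n} (hX : X ∈ psdCone n) (hS : S ∈ psdCone n) :
    0 ≤ ⟪X, S⟫_ℝ := by
  obtain ⟨B, hB⟩ : ∃ B : Matrix (Fin n) (Fin n) ℝ, S.toMatrix = B.conjTranspose * B := by
    open scoped MatrixOrder in
    exact CStarAlgebra.nonneg_iff_eq_star_mul_self.1 (Matrix.nonneg_iff_posSemidef.2 hS)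
  have : ⟪X, S⟫_ℝ = ∑ k, ⟪X, SymMat.outer (B k)⟫_ℝ := by
    simp only [SymMat.inner_eq_sum, SymMat.outer_apply, hB, Matrix.mul_apply,
      Matrix.conjTranspose_apply, star_trivial, Finset.mul_sum]
    rw [Finset.sum_comm_cycle]
  rw [this]
  exact Finset.sum_nonneg fun k _ => mem_psdCone_iff.1 hX _

end PSD

/-! ### Polyhedral cones -/

section Polyhedral

variable {E : Type*} [NormedAddCommGroup E] [InnerProductSpace ℝ E] {Q : Set E}

theorem IsPolyhedralCone.isClosed (hQ : IsPolyhedralCone Q) : IsClosed Q := by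
  obtain ⟨s, rfl⟩ := hQ
  simp only [Set.ofPred_forall]
  exact isClosed_iInter fun a => isClosed_iInter fun _ =>
    isClosed_le (by fun_prop) continuous_const

theorem IsPolyhedralCone.zero_mem (hQ : IsPolyhedralCone Q) : (0 : E) ∈ Q := by
  obtain ⟨s, rfl⟩ := hQ
  simp

theorem IsPolyhedralCone.smul_mem (hQ : IsPolyhedralCone Q) {x : E} (hx : x ∈ Q) {t : ℝ}
    (ht : 0 ≤ t) : t • x ∈ Q := by
  obtain ⟨s, rfl⟩ := hQ
  intro a ha
  rw [real_inner_smul_right]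
  exact mul_nonpos_of_nonneg_of_nonpos ht (hx a ha)

theorem IsPolyhedralCone.add_mem (hQ : IsPolyhedralCone Q) {x y : E} (hx : x ∈ Q) (hy : y ∈ Q) :
    x + y ∈ Q := by
  obtain ⟨s, rfl⟩ := hQ
  intro a ha
  rw [inner_add_right]
  exact add_nonpos (hx a ha) (hy a ha)

end Polyhedral

theorem EReal.le_coe_of_forall_coe_le {x : EReal} {b : ℝ}
    (h : ∀ a : ℝ, (a : EReal) ≤ x → a ≤ b) : x ≤ b := by
  by_contra! hlt
  obtain ⟨r, hr, hrx⟩ := EReal.lt_iff_exists_real_btwn.1 hlt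
  exact absurd (h r hrx.le) (not_le.2 (EReal.coe_lt_coe_iff.1 hr))

namespace SDPData

variable {n : ℕ} {Y W : Type*}
  [NormedAddCommGroup Y] [InnerProductSpace ℝ Y] [FiniteDimensional ℝ Y]
  [NormedAddCommGroup W] [InnerProductSpace ℝ W] [FiniteDimensional ℝ W]
  {P : SDPData n Y W}

/-! ### The dual objective -/

/-- The points of `𝔻` at which the dual objective is finite. -/
def dualDom (P : SDPData n Y W) : Set (DualVar n Y W) := {z | z ∈ P.dualSet ∧ P.dualObj z < ⊤}

/-- The real-valued dual objective, meaningful on `dualDom`. -/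
def dualFun (P : SDPData n Y W) (z : DualVar n Y W) : ℝ := (P.dualObj z).toReal

/-- The residual as an affine map. -/
def residualMap (P : SDPData n Y W) : DualVar n Y W →ᵃ[ℝ] SymMat n where
  toFun := P.residual
  linear :=
    { toFun := fun z => LinearMap.adjoint P.A z.fst + LinearMap.adjoint P.F z.snd.fst + z.snd.snd
      map_add' := fun z z' => by
        simp only [WithLp.add_fst, WithLp.add_snd, map_add]
        abel
      map_smul' := fun t z => by
        simp only [WithLp.smul_fst, WithLp.smul_snd, map_smul, RingHom.id_apply, smul_add] }
  map_vadd' := fun z v => by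
    simp only [residual, vadd_eq_add, WithLp.add_fst, WithLp.add_snd, map_add, LinearMap.coe_mk,
      AddHom.coe_mk]
    abel

theorem residualMap_apply (z : DualVar n Y W) : P.residualMap z = P.residual z := rfl

theorem continuous_residual (P : SDPData n Y W) : Continuous P.residual := by
  have h1 : Continuous fun z : DualVar n Y W => z.fst := by fun_prop
  have h2 : Continuous fun z : DualVar n Y W => z.snd.fst := by fun_prop
  have h3 : Continuous fun z : DualVar n Y W => z.snd.snd := by fun_prop
  exact ((((LinearMap.adjoint P.A).continuous_of_finiteDimensional.comp h1).add
    ((LinearMap.adjoint P.F).continuous_of_finiteDimensional.comp h2)).add h3).sub continuous_const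

/-- Points off dom h contribute ⊥ to the conjugate. Thus ϑ is a supremum of real affine functions of
z, from which its convexity, its closed sublevel sets and the Fenchel–Young inequality are all read
off. -/
theorem dualObj_le_coe_iff (hP : P.Standing) {z : DualVar n Y W} {a : ℝ} :
    P.dualObj z ≤ a ↔
      ∀ x ∈ P.domh, -⟪P.b, z.fst⟫_ℝ + (⟪x, -z.snd.fst⟫_ℝ - (P.h x).toReal) ≤ a := by
  have h1 : P.dualObj z ≤ a ↔ convexConj P.h (-z.snd.fst) ≤ ((a + ⟪P.b, z.fst⟫_ℝ : ℝ) : EReal) := by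
    unfold dualObj
    induction convexConj P.h (-z.snd.fst) with
    | bot => simp
    | top => simp [-EReal.coe_add]
    | coe r =>
      norm_cast
      constructor <;> intro h <;> linarith
  rw [h1, convexConj, iSup_le_iff]
  refine forall_congr' fun x => ?_
  by_cases hx : x ∈ P.domh
  · obtain ⟨r, hr⟩ : ∃ r : ℝ, P.h x = r :=
      ⟨_, (EReal.coe_toReal (ne_of_lt hx) (hP.h_ne_bot x)).symm⟩
    simp only [hx, forall_const]
    rw [hr, EReal.toReal_coe]
    norm_cast
    constructor <;> intro h <;> linarith
  · have : P.h x = ⊤ := not_lt_top_iff.1 hx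
    simp [hx, this]

theorem dualObj_ne_bot (hP : P.Standing) (z : DualVar n Y W) : P.dualObj z ≠ ⊥ := by
  intro h
  obtain ⟨x, hx⟩ := hP.dom_nonempty
  have := (dualObj_le_coe_iff hP (z := z)
    (a := -⟪P.b, z.fst⟫_ℝ + (⟪x, -z.snd.fst⟫_ℝ - (P.h x).toReal) - 1)).1 (by simp [h]) x hx
  linarith

theorem coe_dualFun (hP : P.Standing) {z : DualVar n Y W} (hz : z ∈ P.dualDom) :
    (P.dualFun z : EReal) = P.dualObj z :=
  EReal.coe_toReal (ne_of_lt hz.2) (dualObj_ne_bot hP z)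

theorem isClosed_dualSet (hP : P.Standing) : IsClosed P.dualSet := by
  have h1 : Continuous fun z : DualVar n Y W => z.fst := by fun_prop
  have h2 : Continuous fun z : DualVar n Y W => z.snd.snd := by fun_prop
  exact (hP.polyhedral.isClosed.preimage h1).inter (isClosed_psdCone.preimage h2)

theorem convexOn_dualFun (hP : P.Standing) : ConvexOn ℝ P.dualDom P.dualFun := by
  have key : ∀ z ∈ P.dualDom, ∀ z' ∈ P.dualDom, ∀ s t : ℝ, 0 ≤ s → 0 ≤ t → s + t = 1 →
      s • z + t • z' ∈ P.dualSet ∧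
      P.dualObj (s • z + t • z') ≤ ((s * P.dualFun z + t * P.dualFun z' : ℝ) : EReal) := by
    intro z hz z' hz' s t hs ht hst
    refine ⟨⟨hP.polyhedral.add_mem (hP.polyhedral.smul_mem hz.1.1 hs)
      (hP.polyhedral.smul_mem hz'.1.1 ht), add_mem_psdCone (smul_mem_psdCone hz.1.2 hs)
      (smul_mem_psdCone hz'.1.2 ht)⟩, (dualObj_le_coe_iff hP).2 fun x hx => ?_⟩
    have h1 := (dualObj_le_coe_iff hP).1 (coe_dualFun hP hz).ge x hx
    have h2 := (dualObj_le_coe_iff hP).1 (coe_dualFun hP hz').ge x hx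
    simp only [WithLp.add_fst, WithLp.add_snd, WithLp.smul_fst, WithLp.smul_snd, inner_add_right,
      inner_neg_right, real_inner_smul_right] at h1 h2 ⊢
    obtain rfl : s = 1 - t := by linarith
    have h3 := mul_le_mul_of_nonneg_left h1 hs
    have h4 := mul_le_mul_of_nonneg_left h2 ht
    linarith
  refine ⟨fun z hz z' hz' s t hs ht hst => ?_, fun z hz z' hz' s t hs ht hst => ?_⟩
  · obtain ⟨h1, h2⟩ := key z hz z' hz' s t hs ht hst
    exact ⟨h1, h2.trans_lt (EReal.coe_lt_top _)⟩
  · obtain ⟨h1, h2⟩ := key z hz z' hz' s t hs ht hst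
    rw [← coe_dualFun hP ⟨h1, h2.trans_lt (EReal.coe_lt_top _)⟩] at h2
    exact EReal.coe_le_coe_iff.1 h2

theorem dualObj_le_of_tendsto (hP : P.Standing) {ι : Type*} {l : Filter ι} [l.NeBot]
    {z : ι → DualVar n Y W} {z' : DualVar n Y W} {a : ι → ℝ} {a' : ℝ}
    (hz : Tendsto z l (𝓝 z')) (ha : Tendsto a l (𝓝 a')) (h : ∀ᶠ i in l, P.dualObj (z i) ≤ a i) :
    P.dualObj z' ≤ a' := by
  refine (dualObj_le_coe_iff hP).2 fun x hx => ?_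
  have hc : Continuous fun z : DualVar n Y W =>
      -⟪P.b, z.fst⟫_ℝ + (⟪x, -z.snd.fst⟫_ℝ - (P.h x).toReal) := by fun_prop
  exact le_of_tendsto_of_tendsto ((hc.tendsto z').comp hz) ha
    (h.mono fun i hi => (dualObj_le_coe_iff hP).1 hi x hx)

/-! ### The dual function -/

theorem lagr_of_mem_dualDom (hP : P.Standing) {z : DualVar n Y W} (hz : z ∈ P.dualDom)
    (X : SymMat n) : P.lagr z X = ((P.dualFun z + ⟪X, P.residual z⟫_ℝ : ℝ) : EReal) := by
  rw [lagr, if_pos hz.1, ← coe_dualFun hP hz, EReal.coe_add]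

theorem lagr_of_notMem_dualDom {z : DualVar n Y W} (hz : z ∉ P.dualDom)
    (X : SymMat n) : P.lagr z X = ⊤ := by
  rw [lagr]
  split_ifs with h
  · have : P.dualObj z = ⊤ := not_lt_top_iff.1 fun h' => hz ⟨h, h'⟩
    simp [this]
  · rfl

/-- Presents φ as an infimum of affine functions of X, which yields its concavity and upper
semicontinuity. -/
theorem coe_le_phi_iff (hP : P.Standing) {X : SymMat n} {a : ℝ} :
    (a : EReal) ≤ P.phi X ↔ ∀ z ∈ P.dualDom, a ≤ P.dualFun z + ⟪X, P.residual z⟫_ℝ := by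
  rw [phi, le_iInf_iff]
  refine forall_congr' fun z => ?_
  by_cases hz : z ∈ P.dualDom
  · rw [lagr_of_mem_dualDom hP hz]
    simp only [hz, forall_const, EReal.coe_le_coe_iff]
  · simp [lagr_of_notMem_dualDom hz, hz]

theorem phi_le_coe (hP : P.Standing) {z : DualVar n Y W} (hz : z ∈ P.dualDom) (X : SymMat n) :
    P.phi X ≤ ((P.dualFun z + ⟪X, P.residual z⟫_ℝ : ℝ) : EReal) :=
  (iInf_le _ z).trans (lagr_of_mem_dualDom hP hz X).le

theorem mem_Tphi_iff {X v : SymMat n} :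
    v ∈ P.Tphi X ↔ ∃ m : ℝ, P.phi X = m ∧ ∀ X', P.phi X' ≤ ((m - ⟪v, X' - X⟫_ℝ : ℝ) : EReal) := by
  constructor
  · rintro ⟨h1, h2, h3⟩
    refine ⟨(P.phi X).toReal, (EReal.coe_toReal h1 h2).symm, fun X' => ?_⟩
    have := h3 X'
    rw [← EReal.coe_toReal h1 h2, inner_neg_left] at this
    rw [sub_eq_add_neg]
    exact_mod_cast this
  · rintro ⟨m, h1, h2⟩
    refine ⟨by simp [h1], by simp [h1], fun X' => ?_⟩
    rw [h1, inner_neg_left]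
    have := h2 X'
    rw [sub_eq_add_neg] at this
    exact_mod_cast this

theorem mem_mvInv_Tphi_iff {X : SymMat n} :
    X ∈ mvInv P.Tphi 0 ↔ ∃ m : ℝ, P.phi X = m ∧ ∀ X', P.phi X' ≤ m := by
  rw [mvInv, Set.mem_ofPred_eq, mem_Tphi_iff]
  simp

theorem dualDom_nonempty {X : SymMat n} (h : P.phi X ≠ ⊤) : P.dualDom.Nonempty := by
  by_contra hne
  rw [Set.not_nonempty_iff_eq_empty] at hne
  exact h (iInf_eq_top.2 fun z => lagr_of_notMem_dualDom (by simp [hne]) X)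

theorem augLagr_of_mem_dualDom (hP : P.Standing) {z : DualVar n Y W} (hz : z ∈ P.dualDom)
    (c : ℝ) (X : SymMat n) : P.augLagr c z X =
      ((P.dualFun z + ⟪X, P.residual z⟫_ℝ + c / 2 * ‖P.residual z‖ ^ 2 : ℝ) : EReal) := by
  rw [augLagr, lagr_of_mem_dualDom hP hz, ← EReal.coe_add]

theorem augLagr_of_notMem_dualDom {z : DualVar n Y W} (hz : z ∉ P.dualDom)
    (c : ℝ) (X : SymMat n) : P.augLagr c z X = ⊤ := by
  rw [augLagr, lagr_of_notMem_dualDom hz, EReal.top_add_coe]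

/-- `X + c u` is the proximal point of `φ` at `X`, and `γ` the minimum of the augmented Lagrangian
function. -/
structure IsProx (P : SDPData n Y W) (c : ℝ) (X : SymMat n) (γ : ℝ) (u : SymMat n) : Prop where
  iInf_eq : ⨅ z ∈ P.dualSet, P.augLagr c z X = γ
  le : ∀ z ∈ P.dualDom, c / 2 * ‖u - P.residual z‖ ^ 2 ≤
    P.dualFun z + ⟪X, P.residual z⟫_ℝ + c / 2 * ‖P.residual z‖ ^ 2 - γ
  neg_mem : -u ∈ P.Tphi (X + c • u)

theorem exists_isProx (hP : P.Standing) (hΩ : (mvInv P.Tphi 0).Nonempty) {c : ℝ} (hc : 0 < c)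
    (X : SymMat n) : ∃ γ u, P.IsProx c X γ u := by
  obtain ⟨Xb, hXb⟩ := hΩ
  obtain ⟨m, hm, -⟩ := mem_mvInv_Tphi_iff.1 hXb
  obtain ⟨γ, u, h1, h2, h3⟩ := exists_prox (convexOn_dualFun hP)
    (dualDom_nonempty (X := Xb) (by simp [hm])) P.residualMap ((coe_le_phi_iff hP).1 hm.ge) X hc
  simp only [residualMap_apply] at h1 h2 h3
  have hphi : P.phi (X + c • u) = ((γ + c / 2 * ‖u‖ ^ 2 : ℝ) : EReal) := by
    refine le_antisymm (EReal.le_coe_of_forall_coe_le fun a ha => ?_) ((coe_le_phi_iff hP).2 h2)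
    simpa using h3 (X + c • u) a ((coe_le_phi_iff hP).1 ha)
  refine ⟨γ, u, ?_, fun z hz => ?_, mem_Tphi_iff.2 ⟨_, hphi, fun X' => ?_⟩⟩
  · refine le_antisymm (EReal.le_of_forall_lt_iff_le.1 fun r hr => ?_) (le_iInf₂ fun z _ => ?_)
    · rw [EReal.coe_lt_coe_iff] at hr
      obtain ⟨_, ⟨z, hz, rfl⟩, -, hlt⟩ := h1.exists_between hr
      refine (iInf₂_le z hz.1).trans ?_
      rw [augLagr_of_mem_dualDom hP hz]
      exact_mod_cast hlt.le
    · by_cases hz : z ∈ P.dualDom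
      · rw [augLagr_of_mem_dualDom hP hz]
        exact_mod_cast h1.1 ⟨z, hz, rfl⟩
      · simp [augLagr_of_notMem_dualDom hz]
  -- The optimality bound for the Lagrangian at X + c u, after expansion of ‖u - R z‖².
  · have h := h2 z hz
    rw [inner_add_left, real_inner_smul_left] at h
    rw [norm_sub_sq_real]
    linarith
  · refine EReal.le_coe_of_forall_coe_le fun a ha => ?_
    have := h3 X' a ((coe_le_phi_iff hP).1 ha)
    rw [inner_neg_left]
    linarith

/-- Firm nonexpansiveness of the proximal map, relative to the maximizers of `φ`. -/
theorem IsProx.norm_sq_le {c γ : ℝ} {X u Xb : SymMat n} (h : P.IsProx c X γ u) (hc : 0 < c)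
    (hXb : Xb ∈ mvInv P.Tphi 0) :
    ‖X + c • u - Xb‖ ^ 2 + ‖X + c • u - X‖ ^ 2 ≤ ‖X - Xb‖ ^ 2 := by
  obtain ⟨m, hm, hmax⟩ := mem_mvInv_Tphi_iff.1 hXb
  obtain ⟨p, hp, hsup⟩ := mem_Tphi_iff.1 h.neg_mem
  have h1 := hsup Xb
  have h2 := hmax (X + c • u)
  rw [hm, EReal.coe_le_coe_iff, inner_neg_left] at h1
  rw [hp, EReal.coe_le_coe_iff] at h2
  have e : X - Xb = (X + c • u - Xb) - c • u := by abel
  have e' : Xb - (X + c • u) = -(X + c • u - Xb) := by abel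
  have e2 : ⟪X + c • u - Xb, c • u⟫_ℝ = c * ⟪u, X + c • u - Xb⟫_ℝ := by
    rw [← real_inner_comm]
    exact real_inner_smul_left (F := SymMat n) u _ c
  rw [e, norm_sub_sq_real (X + c • u - Xb) (c • u), add_sub_cancel_left, e2]
  rw [e', inner_neg_right] at h1
  have : c * ⟪u, X + c • u - Xb⟫_ℝ ≤ 0 := mul_nonpos_of_nonneg_of_nonpos hc.le (by linarith)
  linarith

end SDPData

/-! ### Boundedness of minimizing sequences -/

section Minimizing

variable {E H : Type*} [NormedAddCommGroup E] [NormedSpace ℝ E] [ProperSpace E]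
  [NormedAddCommGroup H] [InnerProductSpace ℝ H]

/-- If `min g z` subject to `R z = 0` has a nonempty bounded solution set, then asymptotically
feasible minimizing sequences are bounded. -/
theorem isBounded_range_of_minimizing {D : Set E} {g : E → ℝ} (hg : ConvexOn ℝ D g)
    (R : E →ᵃ[ℝ] H) (hR : Continuous R)
    (hcl : ∀ (z : ℕ → E) (w : E) (a : ℕ → ℝ) (a' : ℝ), Tendsto z atTop (𝓝 w) →
      Tendsto a atTop (𝓝 a') → (∀ j, z j ∈ D ∧ g (z j) ≤ a j) → w ∈ D ∧ g w ≤ a')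
    {d : ℝ} (hne : {z | z ∈ D ∧ R z = 0 ∧ g z ≤ d}.Nonempty)
    (hbd : Bornology.IsBounded {z | z ∈ D ∧ R z = 0 ∧ g z ≤ d}) {z : ℕ → E} {a : ℕ → ℝ}
    (hz : ∀ᶠ k in atTop, z k ∈ D ∧ g (z k) ≤ a k) (ha : Tendsto a atTop (𝓝 d))
    (hRz : Tendsto (fun k => R (z k)) atTop (𝓝 0)) : Bornology.IsBounded (Set.range z) := by
  obtain ⟨zb, hzbD, hzbR, hzbd⟩ := hne
  obtain ⟨r, hr⟩ := hbd.subset_closedBall zb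
  have hr0 : 0 ≤ r := by
    have := hr (show zb ∈ {z | z ∈ D ∧ R z = 0 ∧ g z ≤ d} from ⟨hzbD, hzbR, hzbd⟩)
    simpa using this
  suffices h : ∀ᶠ k in atTop, dist (z k) zb < r + 1 by
    obtain ⟨N, hN⟩ := eventually_atTop.1 h
    refine ((Metric.isBounded_ball (x := zb) (r := r + 1)).union
      ((Set.finite_Iio N).image z).isBounded).subset ?_
    rintro _ ⟨k, rfl⟩
    rcases lt_or_ge k N with hk | hk
    · exact Or.inr ⟨k, hk, rfl⟩
    · exact Or.inl (hN k hk)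
  by_contra hcon
  have hfreq : ∃ᶠ k in atTop, r + 1 ≤ dist (z k) zb ∧ z k ∈ D ∧ g (z k) ≤ a k :=
    ((Filter.not_eventually.1 hcon).mono fun k hk => not_lt.1 hk).and_eventually hz
  obtain ⟨σ, hσ, hσz⟩ := extraction_of_frequently_atTop hfreq
  -- Far iterates are pulled back along segments from the solution zb to the sphere of radius r + 1.
  -- Objective bounds and residuals survive this by convexity, so a limit on the sphere would be a
  -- solution outside the ball of radius r.
  set t : ℕ → ℝ := fun j => (r + 1) / dist (z (σ j)) zb with ht
  have hdpos : ∀ j, 0 < dist (z (σ j)) zb := fun j => by linarith [(hσz j).1]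
  have ht0 : ∀ j, 0 ≤ t j := fun j => by have := hdpos j; simp only [ht]; positivity
  have ht1 : ∀ j, t j ≤ 1 := fun j => (div_le_one (hdpos j)).2 (hσz j).1
  set w : ℕ → E := fun j => zb + t j • (z (σ j) - zb) with hw
  have hwdist : ∀ j, dist (w j) zb = r + 1 := fun j => by
    simp only [hw, dist_eq_norm, add_sub_cancel_left, norm_smul, Real.norm_of_nonneg (ht0 j)]
    simp only [ht, dist_eq_norm]
    exact div_mul_cancel₀ _ (by have := hdpos j; rw [dist_eq_norm] at this; exact this.ne')
  have hwg : ∀ j, w j ∈ D ∧ g (w j) ≤ d + |a (σ j) - d| := fun j => by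
    have e : w j = (1 - t j) • zb + t j • z (σ j) := by simp only [hw]; module
    rw [e]
    have h1 := hg.2 hzbD (hσz j).2.1 (sub_nonneg.2 (ht1 j)) (ht0 j) (by ring)
    refine ⟨hg.1 hzbD (hσz j).2.1 (sub_nonneg.2 (ht1 j)) (ht0 j) (by ring), h1.trans ?_⟩
    have h2 := mul_le_mul_of_nonneg_left hzbd (sub_nonneg.2 (ht1 j))
    have h3 := mul_le_mul_of_nonneg_left (hσz j).2.2 (ht0 j)
    have h4 := mul_le_mul_of_nonneg_left (le_abs_self (a (σ j) - d)) (ht0 j)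
    have h5 := mul_le_mul_of_nonneg_right (ht1 j) (abs_nonneg (a (σ j) - d))
    simp only [smul_eq_mul]
    linarith
  have hwR : ∀ j, ‖R (w j)‖ ≤ ‖R (z (σ j))‖ := fun j => by
    simp only [hw, affineMap_segment, hzbR, zero_add, sub_zero, norm_smul,
      Real.norm_of_nonneg (ht0 j)]
    exact mul_le_of_le_one_left (norm_nonneg _) (ht1 j)
  obtain ⟨w', -, τ, hτ, hw'⟩ := (isCompact_sphere zb (r + 1)).tendsto_subseq
    fun j => Metric.mem_sphere.2 (hwdist j)
  have hστ : Tendsto (fun j => σ (τ j)) atTop atTop := hσ.tendsto_atTop.comp hτ.tendsto_atTop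
  have hlim : Tendsto (fun j => d + |a (σ (τ j)) - d|) atTop (𝓝 d) := by
    simpa using (((ha.comp hστ).sub_const d).abs.const_add d)
  obtain ⟨hw'D, hw'g⟩ := hcl _ _ _ _ hw' hlim fun j => hwg (τ j)
  have hw'R : R w' = 0 := by
    have h1 : Tendsto (fun j => R (w (τ j))) atTop (𝓝 (R w')) := (hR.tendsto w').comp hw'
    have h2 : Tendsto (fun j => R (w (τ j))) atTop (𝓝 0) := by
      refine squeeze_zero_norm (fun j => hwR (τ j)) ?_
      simpa using (hRz.comp hστ).norm
    exact tendsto_nhds_unique h1 h2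
  have h1 : dist w' zb ≤ r := hr ⟨hw'D, hw'R, hw'g⟩
  have h2 : dist w' zb = r + 1 :=
    tendsto_nhds_unique (hw'.dist tendsto_const_nhds) (by simp [hwdist])
  linarith

end Minimizing

/-! ### Norm identities for the multiplier update -/

section InnerSmul

variable {H : Type*} [NormedAddCommGroup H] [InnerProductSpace ℝ H]

theorem norm_add_smul_sub_add_smul_sq (x r u : H) (c : ℝ) :
    ‖x + c • r - (x + c • u)‖ ^ 2 = c ^ 2 * ‖u - r‖ ^ 2 := by
  rw [add_sub_add_left_eq_sub, ← smul_sub, norm_smul, mul_pow, Real.norm_eq_abs, sq_abs,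
    norm_sub_rev]

theorem norm_eq_inv_mul_norm_add_smul_sub {c : ℝ} (hc : 0 < c) (x u : H) :
    ‖u‖ = c⁻¹ * ‖x + c • u - x‖ := by
  rw [add_sub_cancel_left, norm_smul, Real.norm_of_nonneg hc.le, inv_mul_cancel_left₀ hc.ne']

end InnerSmul

namespace SDPData

variable {n : ℕ} {Y W : Type*}
  [NormedAddCommGroup Y] [InnerProductSpace ℝ Y] [FiniteDimensional ℝ Y]
  [NormedAddCommGroup W] [InnerProductSpace ℝ W] [FiniteDimensional ℝ W]
  {P : SDPData n Y W}

/-! ### One step of the augmented Lagrangian method -/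

/-- The properties of a step from `X` to `X'` with the approximate minimizer `z` of the augmented
Lagrangian function, of gap `G`; `p` is the exact proximal step. -/
structure ProxStep (P : SDPData n Y W) (c : ℝ) (X X' : SymMat n) (z : DualVar n Y W) (G : ℝ)
    (p : SymMat n) : Prop where
  mem : z ∈ P.dualDom
  sub_eq : P.augLagr c z X - (⨅ z ∈ P.dualSet, P.augLagr c z X) = G
  le_iff : ∀ e : ℝ, P.augLagr c z X ≤ (⨅ z ∈ P.dualSet, P.augLagr c z X) + (e : EReal) ↔ G ≤ e
  norm_sq_le : ‖X' - p‖ ^ 2 ≤ 2 * c * G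
  exists_mem : ∃ v ∈ P.Tphi p, ‖v‖ = c⁻¹ * ‖p - X‖
  firm : ∀ Xb ∈ mvInv P.Tphi 0, ‖p - Xb‖ ^ 2 + ‖p - X‖ ^ 2 ≤ ‖X - Xb‖ ^ 2
  le_dualVal : ((P.dualFun z + 1 / (2 * c) * (‖X'‖ ^ 2 - ‖X‖ ^ 2) - G : ℝ) : EReal) ≤ P.dualVal

/-- A finite gap forces z into the domain of ϑ, because inf ζ is finite. Since X' - p = c (R z - u),
the strong convexity estimate in `IsProx` bounds the multiplier error by the gap. -/
theorem exists_proxStep (hP : P.Standing) (hΩ : (mvInv P.Tphi 0).Nonempty) {c : ℝ} (hc : 0 < c)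
    {X X' : SymMat n} {z : DualVar n Y W} (hX' : X' = X + c • P.residual z) {e : ℝ}
    (h : P.augLagr c z X ≤ (⨅ z ∈ P.dualSet, P.augLagr c z X) + (e : EReal)) :
    ∃ G p, P.ProxStep c X X' z G p := by
  obtain ⟨γ, u, hu⟩ := exists_isProx hP hΩ hc X
  have hz : z ∈ P.dualDom := by
    by_contra hz
    rw [augLagr_of_notMem_dualDom hz, hu.iInf_eq, ← EReal.coe_add] at h
    exact absurd h (not_le.2 (EReal.coe_lt_top _))
  have haug := augLagr_of_mem_dualDom hP hz c X
  refine ⟨P.dualFun z + ⟪X, P.residual z⟫_ℝ + c / 2 * ‖P.residual z‖ ^ 2 - γ, X + c • u,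
    hz, ?_, fun e => ?_, ?_, ⟨-u, hu.neg_mem, ?_⟩, fun Xb hXb => hu.norm_sq_le hc hXb, ?_⟩
  · rw [haug, hu.iInf_eq, ← EReal.coe_sub]
  · rw [haug, hu.iInf_eq, ← EReal.coe_add, EReal.coe_le_coe_iff, sub_le_iff_le_add, add_comm γ]
  · have h1 := norm_add_smul_sub_add_smul_sq X (P.residual z) u c
    rw [hX']
    refine h1.le.trans ?_
    have h2 := mul_le_mul_of_nonneg_left (hu.le z hz) (by positivity : 0 ≤ 2 * c)
    linarith
  · rw [norm_neg]
    exact norm_eq_inv_mul_norm_add_smul_sub hc X u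
  · have h1 : ‖X'‖ ^ 2 = ‖X‖ ^ 2 + 2 * c * ⟪X, P.residual z⟫_ℝ + c ^ 2 * ‖P.residual z‖ ^ 2 :=
      hX' ▸ norm_add_smul_sq X (P.residual z) c
    -- The bound for the dual value is γ = inf ζ in disguise; at feasible points ζ reduces to ϑ, so
    -- γ ≤ inf ϑ.
    have h2 : P.dualFun z + 1 / (2 * c) * (‖X'‖ ^ 2 - ‖X‖ ^ 2) -
        (P.dualFun z + ⟪X, P.residual z⟫_ℝ + c / 2 * ‖P.residual z‖ ^ 2 - γ) = γ := by
      rw [h1]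
      field_simp
      ring
    rw [h2, dualVal, ← hu.iInf_eq]
    refine le_iInf₂ fun z' hz' => (iInf₂_le z' hz'.1).trans ?_
    rw [augLagr, lagr, if_pos hz'.1, hz'.2]
    simp

theorem ProxStep.dualObj_sub_le (hP : P.Standing) {c : ℝ} {X X' : SymMat n}
    {z : DualVar n Y W} {G : ℝ} {p : SymMat n} (h : P.ProxStep c X X' z G p) :
    P.dualObj z - P.dualVal ≤ ((G + 1 / (2 * c) * (‖X‖ ^ 2 - ‖X'‖ ^ 2) : ℝ) : EReal) := by
  have h1 := h.le_dualVal
  rw [← coe_dualFun hP h.mem]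
  induction hd : P.dualVal with
  | bot =>
    rw [hd, le_bot_iff] at h1
    exact absurd h1 (EReal.coe_ne_bot _)
  | top => simp
  | coe d =>
    rw [hd, EReal.coe_le_coe_iff] at h1
    rw [← EReal.coe_sub, EReal.coe_le_coe_iff]
    linarith

/-- The supergradient inequality at p k, tested at a maximizer Xb, gives max φ ≤ φ(p k) - ⟪v k, Xb -
p k⟫. Bounding φ(p k) by one affine function at a time allows passage to the limit. -/
theorem mem_mvInv_Tphi_of_tendsto (hP : P.Standing) (hΩ : (mvInv P.Tphi 0).Nonempty)
    {p v : ℕ → SymMat n} {y : SymMat n} (hv : ∀ k, v k ∈ P.Tphi (p k))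
    (hv0 : Tendsto v atTop (𝓝 0)) (hp : Tendsto p atTop (𝓝 y)) : y ∈ mvInv P.Tphi 0 := by
  obtain ⟨Xb, hXb⟩ := hΩ
  obtain ⟨m, hm, hmax⟩ := mem_mvInv_Tphi_iff.1 hXb
  refine mem_mvInv_Tphi_iff.2 ⟨m, le_antisymm (hmax y) ((coe_le_phi_iff hP).2 fun z hz => ?_), hmax⟩
  have hlim : Tendsto (fun k => P.dualFun z + ⟪p k, P.residual z⟫_ℝ - ⟪v k, Xb - p k⟫_ℝ) atTop
      (𝓝 (P.dualFun z + ⟪y, P.residual z⟫_ℝ - ⟪(0 : SymMat n), Xb - y⟫_ℝ)) :=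
    ((hp.inner tendsto_const_nhds).const_add _).sub (hv0.inner (tendsto_const_nhds.sub hp))
  rw [inner_zero_left, sub_zero] at hlim
  refine ge_of_tendsto' hlim fun k => ?_
  obtain ⟨q, hq, hsup⟩ := mem_Tphi_iff.1 (hv k)
  have h1 := hsup Xb
  have h2 := (coe_le_phi_iff hP).1 hq.ge z hz
  rw [hm, EReal.coe_le_coe_iff] at h1
  linarith

/-! ### Dual solutions -/

theorem psi_of_mem_dualFeasible {z : DualVar n Y W} (hz : z ∈ P.dualFeasible) :
    P.psi z = P.dualObj z := by
  have : ∀ X, P.lagr z X = P.dualObj z := fun X => by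
    rw [lagr, if_pos hz.1, hz.2, inner_zero_right, EReal.coe_zero, add_zero]
  simp only [psi, this, ciSup_const]

/-- Multipliers along a nonzero residual drive the Lagrangian to ∞, so ψ is ϑ plus the indicator of
the feasible set. -/
theorem psi_of_notMem_dualFeasible (hP : P.Standing) {z : DualVar n Y W}
    (hz : z ∉ P.dualFeasible) : P.psi z = ⊤ := by
  by_cases hzD : z ∈ P.dualDom
  · have hR : 0 < ‖P.residual z‖ ^ 2 := by
      have : P.residual z ≠ 0 := fun h => hz ⟨hzD.1, h⟩
      positivity
    refine EReal.eq_top_iff_forall_lt _ |>.2 fun r => ?_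
    refine lt_of_lt_of_le ?_
      (le_iSup (P.lagr z) (((r - P.dualFun z + 1) / ‖P.residual z‖ ^ 2) • P.residual z))
    have h1 : ⟪((r - P.dualFun z + 1) / ‖P.residual z‖ ^ 2) • P.residual z, P.residual z⟫_ℝ =
        r - P.dualFun z + 1 := by
      refine (real_inner_smul_left (F := SymMat n) _ _ _).trans ?_
      rw [real_inner_self_eq_norm_sq, div_mul_cancel₀ _ hR.ne']
    rw [lagr_of_mem_dualDom hP hzD, h1, EReal.coe_lt_coe_iff]
    linarith
  · simp only [psi, lagr_of_notMem_dualDom hzD, ciSup_const]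

set_option synthInstance.maxHeartbeats 200000 in
theorem mvInv_Tpsi (hP : P.Standing) : mvInv P.Tpsi 0 = P.dualSol := by
  ext z
  constructor
  · rintro ⟨h1, h2, h3⟩
    have hz : z ∈ P.dualFeasible := by
      by_contra hz
      exact h1 (psi_of_notMem_dualFeasible hP hz)
    rw [psi_of_mem_dualFeasible hz] at h1 h3
    refine ⟨hz, lt_top_iff_ne_top.2 h1, fun z' hz' => ?_⟩
    have := h3 z'
    simpa [psi_of_mem_dualFeasible hz'] using this
  · rintro ⟨hz, h1, h2⟩
    have e := psi_of_mem_dualFeasible hz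
    refine ⟨by rw [e]; exact h1.ne, by rw [e]; exact dualObj_ne_bot hP z, fun z' => ?_⟩
    rw [e, inner_zero_left, EReal.coe_zero, add_zero]
    by_cases hz' : z' ∈ P.dualFeasible
    · rw [psi_of_mem_dualFeasible hz']
      exact h2 z' hz'
    · rw [psi_of_notMem_dualFeasible hP hz']
      exact le_top

/-- Attainment makes the optimal value real and gives the solution set the sublevel form needed in
`isBounded_range_of_minimizing`. -/
theorem exists_dualVal_eq (hP : P.Standing) (hne : P.dualSol.Nonempty) :
    ∃ d : ℝ, P.dualVal = d ∧
      P.dualSol = {z | z ∈ P.dualDom ∧ P.residualMap z = 0 ∧ P.dualFun z ≤ d} := by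
  obtain ⟨zb, hzb, htop, hmin⟩ := hne
  have hzbD : zb ∈ P.dualDom := ⟨hzb.1, htop⟩
  have hval : P.dualVal = P.dualFun zb :=
    (le_antisymm (iInf₂_le zb hzb) (le_iInf₂ hmin)).trans (coe_dualFun hP hzbD).symm
  refine ⟨P.dualFun zb, hval, Set.ext fun z => ⟨fun hz => ?_, fun hz => ?_⟩⟩
  · have hzD : z ∈ P.dualDom := ⟨hz.1.1, hz.2.1⟩
    refine ⟨hzD, hz.1.2, ?_⟩
    have := hz.2.2 zb hzb
    rwa [← coe_dualFun hP hzD, ← coe_dualFun hP hzbD, EReal.coe_le_coe_iff] at this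
  · refine ⟨⟨hz.1.1, hz.2.1⟩, hz.1.2, fun z' hz' => ?_⟩
    rw [← coe_dualFun hP hz.1]
    refine (EReal.coe_le_coe_iff.2 hz.2.2).trans ?_
    rw [coe_dualFun hP hzbD]
    exact hmin z' hz'

theorem dualVar_properSpace : ProperSpace (DualVar n Y W) := by
  have : FiniteDimensional ℝ (WithLp 2 (W × SymMat n)) := inferInstance
  exact FiniteDimensional.proper ℝ (WithLp 2 (Y × WithLp 2 (W × SymMat n)))

set_option synthInstance.maxHeartbeats 200000 in
/-- Asymptotically feasible minimizing sequences of the dual problem. -/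
theorem isBounded_and_mem_dualSol (hP : P.Standing) (hne : P.dualSol.Nonempty)
    (hbd : Bornology.IsBounded P.dualSol) {z : ℕ → DualVar n Y W} {b : ℕ → ℝ}
    (hz : ∀ᶠ k in atTop, z k ∈ P.dualDom ∧ (P.dualFun (z k) - b k : ℝ) ≤ P.dualVal)
    (hb : Tendsto b atTop (𝓝 0)) (hR : Tendsto (fun k => P.residual (z k)) atTop (𝓝 0)) :
    Bornology.IsBounded (Set.range z) ∧ ∀ z', MapClusterPt z' atTop z → z' ∈ P.dualSol := by
  obtain ⟨d, hd, hsol⟩ := exists_dualVal_eq hP hne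
  have hz' : ∀ᶠ k in atTop, z k ∈ P.dualDom ∧ P.dualFun (z k) ≤ d + b k :=
    hz.mono fun k hk => ⟨hk.1, by
      have := hk.2
      rw [hd, EReal.coe_le_coe_iff] at this
      linarith⟩
  have hlim : Tendsto (fun k => d + b k) atTop (𝓝 d) := by simpa using hb.const_add d
  -- General filters are allowed because boundedness uses `atTop`, while cluster points are reached
  -- through an ultrafilter.
  have hcl : ∀ (l : Filter ℕ) [l.NeBot] (z : ℕ → DualVar n Y W) (w : DualVar n Y W) (a : ℕ → ℝ)
      (a' : ℝ), Tendsto z l (𝓝 w) → Tendsto a l (𝓝 a') →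
      (∀ᶠ j in l, z j ∈ P.dualDom ∧ P.dualFun (z j) ≤ a j) → w ∈ P.dualDom ∧ P.dualFun w ≤ a' := by
    intro l _ z w a a' hz ha h
    have h1 : w ∈ P.dualSet := (isClosed_dualSet hP).mem_of_tendsto hz (h.mono fun j hj => hj.1.1)
    have h2 : P.dualObj w ≤ a' := dualObj_le_of_tendsto hP hz ha (h.mono fun j hj => by
      rw [← coe_dualFun hP hj.1]
      exact_mod_cast hj.2)
    have h3 : w ∈ P.dualDom := ⟨h1, h2.trans_lt (EReal.coe_lt_top _)⟩
    refine ⟨h3, ?_⟩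
    rw [← coe_dualFun hP h3] at h2
    exact_mod_cast h2
  refine ⟨?_, fun w hw => ?_⟩
  · have : ProperSpace (DualVar n Y W) := dualVar_properSpace
    rw [hsol] at hne hbd
    exact isBounded_range_of_minimizing (convexOn_dualFun hP) P.residualMap P.continuous_residual
      (fun z w a a' h1 h2 h3 => hcl atTop z w a a' h1 h2 (Eventually.of_forall h3)) hne hbd hz' hlim
      hR
  · obtain ⟨U, hU, hUw⟩ := mapClusterPt_iff_ultrafilter.1 hw
    obtain ⟨h1, h2⟩ := hcl U z w _ d hUw (hlim.mono_left hU) (hz'.filter_mono hU)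
    rw [hsol]
    exact ⟨h1, tendsto_nhds_unique ((P.continuous_residual.tendsto w).comp hUw)
      (hR.mono_left hU), h2⟩

end SDPData

/-! ### Limits of the rate constants -/

section Rates

/-- Monotonicity gives c_∞ ≥ c 0 > 0, so c_∞ is either a positive real or ⊤. -/
theorem tendsto_inv_recipLim {c : ℕ → ℝ} {cInf : EReal} (hc : ∀ k, 0 < c k) (hmono : Monotone c)
    (hlim : Tendsto (fun k => (c k : EReal)) atTop (𝓝 cInf)) :
    Tendsto (fun k => (c k)⁻¹) atTop (𝓝 (recipLim cInf)) ∧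
      ∀ κ : ℝ, 0 < κ → Tendsto (fun k => κ / √(κ ^ 2 + c k ^ 2)) atTop (𝓝 (thetaLim κ cInf)) ∧
        thetaLim κ cInf < 1 := by
  have h0 : ((c 0 : ℝ) : EReal) ≤ cInf :=
    ge_of_tendsto' hlim fun k => EReal.coe_le_coe_iff.2 (hmono (Nat.zero_le k))
  induction cInf with
  | bot => simp at h0
  | top =>
    have h1 : Tendsto c atTop atTop := EReal.tendsto_coe_nhds_top_iff.1 hlim
    refine ⟨by simpa [recipLim, Function.comp_def] using tendsto_inv_atTop_zero.comp h1, fun κ hκ => ⟨?_, by simp [thetaLim]⟩⟩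
    simp only [thetaLim, if_true]
    have h2 : Tendsto (fun k => √(κ ^ 2 + c k ^ 2)) atTop atTop := by
      refine tendsto_atTop_mono (fun k => ?_) h1
      exact Real.le_sqrt_of_sq_le (by nlinarith [sq_nonneg κ])
    exact h2.const_div_atTop κ
  | coe r =>
    have h1 : Tendsto c atTop (𝓝 r) := EReal.tendsto_coe.1 hlim
    have hr : 0 < r := (hc 0).trans_le (EReal.coe_le_coe_iff.1 h0)
    refine ⟨by simpa [recipLim] using h1.inv₀ hr.ne', fun κ hκ => ?_⟩
    simp only [thetaLim, EReal.coe_ne_top, if_false, EReal.toReal_coe]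
    have hpos : 0 < √(κ ^ 2 + r ^ 2) := by positivity
    refine ⟨tendsto_const_nhds.div (((h1.pow 2).const_add _).sqrt) hpos.ne', ?_⟩
    rw [div_lt_one hpos]
    exact Real.lt_sqrt_of_sq_lt (by nlinarith)

/-- The majorant is (|l| + 1) d (k - 1): its constant eventually dominates m, and the shift matches
the bound at k + 1 by d k. -/
theorem rSuperlinear_of_succ_le {f : ℕ → EReal} {d m : ℕ → ℝ} {l : ℝ} (hd : QSuperlinear d)
    (hm : Tendsto m atTop (𝓝 l)) (h : ∀ᶠ k in atTop, f (k + 1) ≤ ((m k * d k : ℝ) : EReal)) :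
    RSuperlinear f := by
  obtain ⟨hd0, hdlim, θ, hθ, hdθ⟩ := hd
  have hM : 0 ≤ |l| + 1 := by positivity
  refine ⟨fun k => (|l| + 1) * d (k - 1), ⟨fun k => mul_nonneg hM (hd0 _), ?_, fun k => θ (k - 1),
    ?_, ?_⟩, ?_⟩
  · rw [← tendsto_add_atTop_iff_nat 1]
    simpa using hdlim.const_mul (|l| + 1)
  · rw [← tendsto_add_atTop_iff_nat 1]
    simpa using hθ
  · obtain ⟨N, hN⟩ := eventually_atTop.1 hdθ
    refine eventually_atTop.2 ⟨N + 1, fun k hk => ?_⟩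
    obtain ⟨j, rfl⟩ : ∃ j, k = j + 1 := ⟨k - 1, by omega⟩
    have := mul_le_mul_of_nonneg_left (hN j (by omega)) hM
    simp only [Nat.add_sub_cancel]
    linarith
  · have hml : ∀ᶠ k in atTop, m k ≤ |l| + 1 :=
      hm.eventually_le_const (by linarith [le_abs_self l])
    obtain ⟨N, hN⟩ := eventually_atTop.1 (hml.and h)
    refine eventually_atTop.2 ⟨N + 1, fun k hk => ?_⟩
    obtain ⟨j, rfl⟩ : ∃ j, k = j + 1 := ⟨k - 1, by omega⟩
    obtain ⟨h1, h2⟩ := hN j (by omega)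
    refine h2.trans (EReal.coe_le_coe_iff.2 ?_)
    simpa using mul_le_mul_of_nonneg_right h1 (hd0 j)

end Rates

namespace SDPData

variable {n : ℕ} {Y W : Type*}
  [NormedAddCommGroup Y] [InnerProductSpace ℝ Y] [FiniteDimensional ℝ Y]
  [NormedAddCommGroup W] [InnerProductSpace ℝ W] [FiniteDimensional ℝ W]
  {P : SDPData n Y W}

/-! ### Distance estimates for a single step -/

section Step

variable {c : ℝ} {X X' : SymMat n} {z : DualVar n Y W} {G : ℝ} {p : SymMat n}

theorem ProxStep.gap_nonneg (h : P.ProxStep c X X' z G p) (hc : 0 < c) : 0 ≤ G := by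
  have h1 : 0 ≤ 2 * c * G := (sq_nonneg _).trans h.norm_sq_le
  exact nonneg_of_mul_nonneg_right h1 (by positivity)

theorem ProxStep.norm_le (h : P.ProxStep c X X' z G p) (hc : 0 < c) {e : ℝ} (he : 0 ≤ e)
    (hG : G ≤ e ^ 2 / (2 * c)) : ‖X' - p‖ ≤ e := by
  refine le_of_sq_le_sq (h.norm_sq_le.trans ?_) he
  rw [le_div_iff₀ (by positivity)] at hG
  linarith

/-- The inequality `firm` holds for every point of Ω, so it passes to the infimum; with the square
root, no nearest point is needed. -/
theorem ProxStep.infDist_sq_le (h : P.ProxStep c X X' z G p) (hΩ : (mvInv P.Tphi 0).Nonempty) :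
    Metric.infDist p (mvInv P.Tphi 0) ^ 2 + ‖p - X‖ ^ 2 ≤
      Metric.infDist X (mvInv P.Tphi 0) ^ 2 := by
  have h1 : √(Metric.infDist p (mvInv P.Tphi 0) ^ 2 + ‖p - X‖ ^ 2) ≤
      Metric.infDist X (mvInv P.Tphi 0) := by
    refine (Metric.le_infDist hΩ).2 fun Xb hXb => ?_
    rw [dist_eq_norm, Real.sqrt_le_left (norm_nonneg _)]
    refine le_trans ?_ (h.firm Xb hXb)
    have h2 := Metric.infDist_le_dist_of_mem (x := p) hXb
    rw [dist_eq_norm] at h2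
    have := pow_le_pow_left₀ Metric.infDist_nonneg h2 2
    linarith
  exact (Real.sqrt_le_left Metric.infDist_nonneg).1 h1

/-- The exact step is no longer than dist(X, Ω), and the relative error is absorbed on the left by
the triangle inequality. -/
theorem ProxStep.norm_sub_le (h : P.ProxStep c X X' z G p) (hΩ : (mvInv P.Tphi 0).Nonempty)
    {η : ℝ} (hη : η < 1) (hX : ‖X' - p‖ ≤ η * ‖X' - X‖) :
    ‖X' - X‖ ≤ (1 - η)⁻¹ * Metric.infDist X (mvInv P.Tphi 0) := by
  have h1 : ‖p - X‖ ≤ Metric.infDist X (mvInv P.Tphi 0) := by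
    have h0 := h.infDist_sq_le hΩ
    have h0' := sq_nonneg (Metric.infDist p (mvInv P.Tphi 0))
    exact le_of_sq_le_sq (by linarith) Metric.infDist_nonneg
  have h2 : ‖X' - X‖ ≤ ‖X' - p‖ + ‖p - X‖ := norm_sub_le_norm_sub_add_norm_sub _ _ _
  rw [inv_mul_eq_div, le_div_iff₀ (by linarith)]
  linarith

/-- The vector v ∈ T_φ(p) of norm ‖p - X‖/c turns subregularity into c dist(p, Ω) ≤ κ‖p - X‖.
Eliminating ‖p - X‖ by `infDist_sq_le` gives the factor. -/
theorem ProxStep.infDist_le_of_subregular (h : P.ProxStep c X X' z G p) (hc : 0 < c)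
    (hΩ : (mvInv P.Tphi 0).Nonempty) {κ : ℝ} (hκ : 0 < κ)
    (hsub : (P.Tphi p).Nonempty → Metric.infEDist p (mvInv P.Tphi 0) ≤
      ENNReal.ofReal κ * Metric.infEDist 0 (P.Tphi p)) :
    Metric.infDist p (mvInv P.Tphi 0) ≤
      κ / √(κ ^ 2 + c ^ 2) * Metric.infDist X (mvInv P.Tphi 0) := by
  obtain ⟨v, hv, hvn⟩ := h.exists_mem
  set dp := Metric.infDist p (mvInv P.Tphi 0) with hdp
  set dX := Metric.infDist X (mvInv P.Tphi 0) with hdX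
  have h1 : dp ≤ κ * (c⁻¹ * ‖p - X‖) := by
    have h2 : Metric.infEDist p (mvInv P.Tphi 0) ≤ ENNReal.ofReal (κ * ‖v‖) := by
      refine (hsub ⟨v, hv⟩).trans ?_
      rw [ENNReal.ofReal_mul hκ.le]
      gcongr
      refine (Metric.infEDist_le_edist_of_mem hv).trans ?_
      rw [edist_dist, dist_zero_left]
    rw [← hvn]
    exact ENNReal.toReal_le_of_le_ofReal (by positivity) h2
  have h2 := h.infDist_sq_le hΩ
  have hdp0 : 0 ≤ dp := Metric.infDist_nonneg
  have hdX0 : 0 ≤ dX := Metric.infDist_nonneg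
  have h3 : c * dp ≤ κ * ‖p - X‖ := by
    have := mul_le_mul_of_nonneg_left h1 hc.le
    calc c * dp ≤ c * (κ * (c⁻¹ * ‖p - X‖)) := this
      _ = κ * ‖p - X‖ := by field_simp
  have h4 : (c * dp) ^ 2 ≤ (κ * ‖p - X‖) ^ 2 := pow_le_pow_left₀ (by positivity) h3 2
  have hpos : 0 < √(κ ^ 2 + c ^ 2) := by positivity
  rw [div_mul_eq_mul_div, le_div_iff₀ hpos]
  refine le_of_sq_le_sq ?_ (by positivity)
  rw [mul_pow, Real.sq_sqrt (by positivity)]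
  have := mul_le_mul_of_nonneg_left h2 (sq_nonneg κ)
  linarith

theorem ProxStep.infDist_le_thetaRate (h : P.ProxStep c X X' z G p) (hc : 0 < c)
    (hΩ : (mvInv P.Tphi 0).Nonempty) {κ η : ℝ} (hκ : 0 < κ) (hη0 : 0 ≤ η) (hη : η < 1)
    (hX : ‖X' - p‖ ≤ η * ‖X' - X‖)
    (hsub : (P.Tphi p).Nonempty → Metric.infEDist p (mvInv P.Tphi 0) ≤
      ENNReal.ofReal κ * Metric.infEDist 0 (P.Tphi p)) :
    Metric.infDist X' (mvInv P.Tphi 0) ≤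
      thetaRate κ c η * Metric.infDist X (mvInv P.Tphi 0) := by
  have h1 := h.infDist_le_of_subregular hc hΩ hκ hsub
  have h2 := h.norm_sub_le hΩ hη hX
  have h3 : Metric.infDist X' (mvInv P.Tphi 0) ≤ Metric.infDist p (mvInv P.Tphi 0) + ‖X' - p‖ := by
    rw [← dist_eq_norm]
    exact Metric.infDist_le_infDist_add_dist
  have h4 := mul_le_mul_of_nonneg_left h2 hη0
  have hd : 0 ≤ Metric.infDist X (mvInv P.Tphi 0) := Metric.infDist_nonneg
  have hinv : 1 ≤ (1 - η)⁻¹ := (one_le_inv₀ (by linarith)).2 (by linarith)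
  have hq : 0 ≤ κ / √(κ ^ 2 + c ^ 2) := by positivity
  -- The triangle inequality gives the left-hand factor, which is sharper than the stated rate.
  have h5 : κ / √(κ ^ 2 + c ^ 2) + η * (1 - η)⁻¹ ≤ thetaRate κ c η := by
    unfold thetaRate
    have : 0 ≤ η * (1 - η)⁻¹ := by positivity
    have := mul_le_mul_of_nonneg_left hinv hq
    linarith
  have h6 := mul_le_mul_of_nonneg_right h5 hd
  linarith

/-- Both the gap and the difference of squares carry a factor ‖X' - X‖, which `norm_sub_le` bounds
by dist(X, Ω). -/
theorem ProxStep.dualObj_sub_le_tauRate (hP : P.Standing) (h : P.ProxStep c X X' z G p)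
    (hc : 0 < c) (hΩ : (mvInv P.Tphi 0).Nonempty) {η : ℝ} (hη : η < 1)
    (hX : ‖X' - p‖ ≤ η * ‖X' - X‖) (hG : G ≤ η ^ 2 / (2 * c) * ‖X' - X‖ ^ 2) :
    P.dualObj z - P.dualVal ≤
      ((tauRate' c η X X' * Metric.infDist X (mvInv P.Tphi 0) : ℝ) : EReal) := by
  refine (h.dualObj_sub_le hP).trans (EReal.coe_le_coe_iff.2 ?_)
  have h1 := h.norm_sub_le hΩ hη hX
  have h2 : ‖X‖ ^ 2 - ‖X'‖ ^ 2 ≤ ‖X' - X‖ * (‖X'‖ + ‖X‖) := by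
    have h3 : ‖X‖ - ‖X'‖ ≤ ‖X' - X‖ := by
      rw [norm_sub_rev]
      exact norm_sub_norm_le X X'
    nlinarith [norm_nonneg X, norm_nonneg X']
  have h3 : 1 / (2 * c) * (‖X‖ ^ 2 - ‖X'‖ ^ 2) ≤ 1 / (2 * c) * (‖X' - X‖ * (‖X'‖ + ‖X‖)) :=
    mul_le_mul_of_nonneg_left h2 (by positivity)
  have h4 : 1 / (2 * c) * (η ^ 2 * ‖X' - X‖ + ‖X'‖ + ‖X‖) * ‖X' - X‖ ≤
      1 / (2 * c) * (η ^ 2 * ‖X' - X‖ + ‖X'‖ + ‖X‖) *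
        ((1 - η)⁻¹ * Metric.infDist X (mvInv P.Tphi 0)) :=
    mul_le_mul_of_nonneg_left h1 (by positivity)
  have h5 : tauRate' c η X X' * Metric.infDist X (mvInv P.Tphi 0) =
      1 / (2 * c) * (η ^ 2 * ‖X' - X‖ + ‖X'‖ + ‖X‖) *
        ((1 - η)⁻¹ * Metric.infDist X (mvInv P.Tphi 0)) := by
    unfold tauRate' tauRate
    field_simp
  have h6 : η ^ 2 / (2 * c) * ‖X' - X‖ ^ 2 + 1 / (2 * c) * (‖X' - X‖ * (‖X'‖ + ‖X‖)) =
      1 / (2 * c) * (η ^ 2 * ‖X' - X‖ + ‖X'‖ + ‖X‖) * ‖X' - X‖ := by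
    ring
  rw [h5]
  linarith

end Step

/-! ### Convergence of the augmented Lagrangian method -/

theorem exists_proxSteps (hP : P.Standing) (hΩ : (mvInv P.Tphi 0).Nonempty) {c : ℕ → ℝ}
    {z : ℕ → DualVar n Y W} {X : ℕ → SymMat n} {ε : ℕ → ℝ} (hc : ∀ k, 0 < c k)
    (hALM : P.IsALM c z X) (hA : P.CritA c z X ε) :
    ∃ (G : ℕ → ℝ) (p : ℕ → SymMat n), ∀ k,
      P.ProxStep (c k) (X k) (X (k + 1)) (z (k + 1)) (G k) (p k) := by
  have h := fun k => exists_proxStep hP hΩ (hc k) (hALM.X_eq k) (hA.le k)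
  choose G p hGp using h
  exact ⟨G, p, hGp⟩

section Sequence

variable {c : ℕ → ℝ} {cInf : EReal} {z : ℕ → DualVar n Y W} {X : ℕ → SymMat n} {ε : ℕ → ℝ}
  {G : ℕ → ℝ} {p : ℕ → SymMat n}

theorem exists_tendsto_of_proxSteps (hP : P.Standing) (hΩ : (mvInv P.Tphi 0).Nonempty)
    (hc : ∀ k, 0 < c k) (hmono : Monotone c)
    (hlim : Tendsto (fun k => (c k : EReal)) atTop (𝓝 cInf)) (hε : ∀ k, 0 ≤ ε k)
    (hsum : Summable ε)
    (hstep : ∀ k, P.ProxStep (c k) (X k) (X (k + 1)) (z (k + 1)) (G k) (p k))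
    (hG : ∀ k, G k ≤ ε k ^ 2 / (2 * c k)) :
    Tendsto (fun k => p k - X k) atTop (𝓝 0) ∧
      ∃ Xinf ∈ mvInv P.Tphi 0, Tendsto X atTop (𝓝 Xinf) := by
  refine exists_tendsto_of_inexact_prox hΩ hε hsum (fun k => (hstep k).firm)
    (fun k => (hstep k).norm_le (hc k) (hε k) (hG k)) fun σ y hσ hpX hpy => ?_
  choose v hv hvn using fun k => (hstep k).exists_mem
  have hv0 : Tendsto v atTop (𝓝 0) := by
    rw [tendsto_zero_iff_norm_tendsto_zero]
    simp only [hvn]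
    simpa using (tendsto_inv_recipLim hc hmono hlim).1.mul hpX.norm
  exact mem_mvInv_Tphi_of_tendsto hP hΩ (fun k => hv (σ k)) (hv0.comp hσ.tendsto_atTop) hpy

theorem tendsto_gap (hc : ∀ k, 0 < c k) (hmono : Monotone c)
    (hlim : Tendsto (fun k => (c k : EReal)) atTop (𝓝 cInf)) (hsum : Summable ε)
    (hstep : ∀ k, P.ProxStep (c k) (X k) (X (k + 1)) (z (k + 1)) (G k) (p k))
    (hG : ∀ k, G k ≤ ε k ^ 2 / (2 * c k)) {Xinf : SymMat n} (hX : Tendsto X atTop (𝓝 Xinf)) :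
    Tendsto (fun k => G k + 1 / (2 * c k) * (‖X k‖ ^ 2 - ‖X (k + 1)‖ ^ 2)) atTop (𝓝 0) := by
  have hinv := (tendsto_inv_recipLim hc hmono hlim).1
  have h1 : Tendsto (fun k => 1 / (2 * c k)) atTop (𝓝 (1 / 2 * recipLim cInf)) := by
    refine (hinv.const_mul (1 / 2)).congr fun k => ?_
    have := (hc k).ne'
    field_simp
  have h2 : Tendsto G atTop (𝓝 0) := by
    refine squeeze_zero (fun k => (hstep k).gap_nonneg (hc k)) hG ?_
    have := (hsum.tendsto_atTop_zero.pow 2).mul h1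
    simpa [div_eq_mul_inv] using this
  have h3 := h1.mul ((hX.norm.pow 2).sub ((hX.comp (tendsto_add_atTop_nat 1)).norm.pow 2))
  simpa using h2.add h3

end Sequence

end SDPData

/-! ### Product distances and subgradients of the Lagrangian -/

section WithLpProd

variable {E H : Type*} [NormedAddCommGroup E] [NormedAddCommGroup H]

theorem WithLp.norm_prod_le_add (u : WithLp 2 (E × H)) : ‖u‖ ≤ ‖u.fst‖ + ‖u.snd‖ := by
  refine le_of_sq_le_sq ?_ (by positivity)
  rw [WithLp.prod_norm_sq_eq_of_L2]
  nlinarith [norm_nonneg u.fst, norm_nonneg u.snd]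

theorem WithLp.dist_fst_le_dist (u v : WithLp 2 (E × H)) : dist u.fst v.fst ≤ dist u v := by
  rw [dist_eq_norm, dist_eq_norm]
  refine le_of_sq_le_sq ?_ (norm_nonneg _)
  rw [WithLp.prod_norm_sq_eq_of_L2, WithLp.sub_fst]
  nlinarith [sq_nonneg ‖(u - v).snd‖]

theorem WithLp.infEDist_fst_le {S : Set E} {T : Set (WithLp 2 (E × H))}
    (h : ∀ q ∈ T, q.fst ∈ S) (u : WithLp 2 (E × H)) :
    Metric.infEDist u.fst S ≤ Metric.infEDist u T := by
  refine Metric.le_infEDist.2 fun q hq => (Metric.infEDist_le_edist_of_mem (h q hq)).trans ?_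
  rw [edist_dist, edist_dist]
  exact ENNReal.ofReal_le_ofReal (WithLp.dist_fst_le_dist u q)

theorem WithLp.infDist_prod_singleton_le {S : Set E} (hS : S.Nonempty) (y : H)
    (u : WithLp 2 (E × H)) :
    Metric.infDist u {q | q.fst ∈ S ∧ q.snd = y} ≤ Metric.infDist u.fst S + dist u.snd y := by
  rw [← sub_le_iff_le_add]
  refine (Metric.le_infDist hS).2 fun s hs => ?_
  rw [sub_le_iff_le_add]
  refine (Metric.infDist_le_dist_of_mem
    (show WithLp.toLp 2 (s, y) ∈ {q : WithLp 2 (E × H) | q.fst ∈ S ∧ q.snd = y} from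
      ⟨hs, rfl⟩)).trans ?_
  rw [dist_eq_norm, dist_eq_norm, dist_eq_norm]
  exact WithLp.norm_prod_le_add _

end WithLpProd

/-- At z the penalty has the same first-order effect as adding c R z to the multiplier; the
difference is quadratic and vanishes to second order along segments. -/
theorem subgradient_of_penalized {E H : Type*} [NormedAddCommGroup E] [InnerProductSpace ℝ E]
    [NormedAddCommGroup H] [InnerProductSpace ℝ H] {D : Set E} {g : E → ℝ}
    (hg : ConvexOn ℝ D g) (R : E →ᵃ[ℝ] H) {X : H} {c : ℝ} {z u : E} (hz : z ∈ D)
    (h : ∀ z' ∈ D, g z + ⟪X, R z⟫_ℝ + c / 2 * ‖R z‖ ^ 2 + ⟪u, z' - z⟫_ℝ ≤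
      g z' + ⟪X, R z'⟫_ℝ + c / 2 * ‖R z'‖ ^ 2) {z' : E} (hz' : z' ∈ D) :
    g z + ⟪X + c • R z, R z⟫_ℝ + ⟪u, z' - z⟫_ℝ ≤ g z' + ⟪X + c • R z, R z'⟫_ℝ := by
  have key : ∀ t : ℝ, 0 < t → t ≤ 1 →
      t * (g z + ⟪X + c • R z, R z⟫_ℝ + ⟪u, z' - z⟫_ℝ - (g z' + ⟪X + c • R z, R z'⟫_ℝ)) ≤
        t ^ 2 * (c / 2 * ‖R z' - R z‖ ^ 2) := by
    intro t ht0 ht1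
    have e : (1 - t) • z + t • z' = z + t • (z' - z) := by module
    have hmem : z + t • (z' - z) ∈ D :=
      e ▸ hg.1 hz hz' (by linarith) ht0.le (by ring)
    have h1 := h _ hmem
    have h2 := hg.2 hz hz' (sub_nonneg.2 ht1) ht0.le (by ring)
    rw [e] at h2
    simp only [affineMap_segment, norm_add_smul_sq, inner_add_right, inner_sub_right,
      real_inner_smul_right, add_sub_cancel_left, real_inner_self_eq_norm_sq] at h1
    simp only [smul_eq_mul] at h2
    simp only [inner_add_left, inner_sub_right, real_inner_smul_left,
      real_inner_self_eq_norm_sq]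
    linarith
  have := nonpos_of_forall_mul_le_sq_mul key
  linarith

namespace SDPData

variable {n : ℕ} {Y W : Type*}
  [NormedAddCommGroup Y] [InnerProductSpace ℝ Y] [FiniteDimensional ℝ Y]
  [NormedAddCommGroup W] [InnerProductSpace ℝ W] [FiniteDimensional ℝ W]
  {P : SDPData n Y W}

set_option synthInstance.maxHeartbeats 200000 in
theorem subdiff_augLagr_subset (hP : P.Standing) {c : ℝ} {X X' : SymMat n} {z : DualVar n Y W}
    (hz : z ∈ P.dualDom) (hX' : X' = X + c • P.residual z) :
    subdiff (fun z => P.augLagr c z X) z ⊆ subdiff (fun z => P.lagr z X') z := by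
  rintro u ⟨-, -, hu⟩
  have hl := lagr_of_mem_dualDom hP hz X'
  refine ⟨by simp [hl, -EReal.coe_add], by simp [hl, -EReal.coe_add], fun z' => ?_⟩
  by_cases hz' : z' ∈ P.dualDom
  · have h1 : ∀ w ∈ P.dualDom, P.dualFun z + ⟪X, P.residualMap z⟫_ℝ +
        c / 2 * ‖P.residualMap z‖ ^ 2 + ⟪u, w - z⟫_ℝ ≤
        P.dualFun w + ⟪X, P.residualMap w⟫_ℝ + c / 2 * ‖P.residualMap w‖ ^ 2 := fun w hw => by
      have := hu w
      simp only [augLagr_of_mem_dualDom hP hz, augLagr_of_mem_dualDom hP hw] at this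
      rwa [← EReal.coe_add, EReal.coe_le_coe_iff] at this
    have h2 := subgradient_of_penalized (convexOn_dualFun hP) P.residualMap hz h1 hz'
    simp only
    rw [hl, lagr_of_mem_dualDom hP hz', ← EReal.coe_add, EReal.coe_le_coe_iff, hX']
    exact h2
  · simp only [lagr_of_notMem_dualDom hz']
    exact le_top

theorem residual_mem_superdiff (hP : P.Standing) {z : DualVar n Y W} (hz : z ∈ P.dualDom)
    (X : SymMat n) : P.residual z ∈ superdiff (fun X => P.lagr z X) X := by
  simp only [superdiff, lagr_of_mem_dualDom hP hz]
  refine ⟨EReal.coe_ne_top _, EReal.coe_ne_bot _, fun X' => ?_⟩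
  rw [← EReal.coe_add, EReal.coe_le_coe_iff, inner_sub_right, real_inner_comm X',
    real_inner_comm X]
  linarith

/-- Pairing a subgradient u of ζ with minus the residual gives an element of T_l at (z, X'), of norm
at most ‖u‖ + ‖R z‖. -/
theorem infEDist_Tl_le (hP : P.Standing) {c : ℝ} {X X' : SymMat n} {z : DualVar n Y W}
    (hz : z ∈ P.dualDom) (hX' : X' = X + c • P.residual z) {e : ℝ} (he : 0 ≤ e)
    (h : Metric.infEDist 0 (subdiff (fun z => P.augLagr c z X) z) ≤ ENNReal.ofReal e) :
    (P.Tl (WithLp.toLp 2 (z, X'))).Nonempty ∧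
      Metric.infEDist 0 (P.Tl (WithLp.toLp 2 (z, X'))) ≤
        ENNReal.ofReal (e + ‖P.residual z‖) := by
  have hmem : ∀ u ∈ subdiff (fun z => P.augLagr c z X) z,
      WithLp.toLp 2 (u, -P.residual z) ∈ P.Tl (WithLp.toLp 2 (z, X')) := fun u hu =>
    ⟨subdiff_augLagr_subset hP hz hX' hu, by
      simpa using residual_mem_superdiff hP hz X'⟩
  have hne : (subdiff (fun z => P.augLagr c z X) z).Nonempty := by
    by_contra hne
    rw [Set.not_nonempty_iff_eq_empty] at hne
    rw [hne, Metric.infEDist_empty] at h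
    exact absurd h (not_le.2 ENNReal.ofReal_lt_top)
  obtain ⟨u, hu⟩ := hne
  refine ⟨⟨_, hmem u hu⟩, ?_⟩
  rw [ENNReal.ofReal_add he (norm_nonneg _)]
  refine le_trans ?_ (add_le_add_left h _)
  rw [← tsub_le_iff_right]
  refine Metric.le_infEDist.2 fun u hu => ?_
  rw [tsub_le_iff_right]
  refine (Metric.infEDist_le_edist_of_mem (hmem u hu)).trans ?_
  rw [edist_dist, edist_dist, dist_zero_left, dist_zero_left,
    ← ENNReal.ofReal_add (norm_nonneg _) (norm_nonneg _)]
  refine ENNReal.ofReal_le_ofReal ((WithLp.norm_prod_le_add _).trans (le_of_eq ?_))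
  simp

-- A zero of T_l is a saddle point: there ψ equals l, and l(·, X) is minimal and lies below ψ.
set_option synthInstance.maxHeartbeats 200000 in
theorem fst_mem_of_mem_mvInv_Tl {q : WithLp 2 (DualVar n Y W × SymMat n)}
    (hq : q ∈ mvInv P.Tl 0) : q.fst ∈ mvInv P.Tpsi 0 := by
  obtain ⟨⟨h1, h2, h3⟩, -, -, h4⟩ := hq
  have h3' : ∀ z, P.lagr q.fst q.snd ≤ P.lagr z q.snd := fun z => by simpa using h3 z
  have h4' : ∀ X, P.lagr q.fst X ≤ P.lagr q.fst q.snd := fun X => by simpa using h4 X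
  have hpsi : P.psi q.fst = P.lagr q.fst q.snd :=
    le_antisymm (iSup_le h4') (le_iSup (P.lagr q.fst) q.snd)
  refine ⟨by rw [hpsi]; exact h1, by rw [hpsi]; exact h2, fun z => ?_⟩
  rw [hpsi, inner_zero_left, EReal.coe_zero, add_zero]
  exact (h3' z).trans (le_iSup (P.lagr z) q.snd)

end SDPData

/-! ### The primal problem -/

/-- The gradient inequality for a convex function. -/
theorem ConvexOn.add_fderiv_le {E : Type*} [NormedAddCommGroup E] [NormedSpace ℝ E] {s : Set E}
    {f : E → ℝ} (hf : ConvexOn ℝ s f) {x y : E} (hx : x ∈ s) (hy : y ∈ s)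
    (hd : DifferentiableAt ℝ f x) : f x + fderiv ℝ f x (y - x) ≤ f y := by
  have h1 : HasDerivAt (fun t : ℝ => f (x + t • (y - x))) (fderiv ℝ f x (y - x)) 0 :=
    hd.hasFDerivAt.hasLineDerivAt (y - x)
  have h2 := (hasDerivAt_iff_tendsto_slope_zero.1 h1).mono_left
    (nhdsWithin_mono 0 fun t (ht : t ∈ Set.Ioi (0 : ℝ)) => ne_of_gt ht)
  have h3 : ∀ᶠ t : ℝ in 𝓝[>] 0,
      t⁻¹ • (f (x + (0 + t) • (y - x)) - f (x + (0 : ℝ) • (y - x))) ≤ f y - f x := by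
    filter_upwards [Ioc_mem_nhdsGT one_pos] with t ht
    have e : x + t • (y - x) = (1 - t) • x + t • y := by module
    have h4 := hf.2 hx hy (sub_nonneg.2 ht.2) ht.1.le (by ring)
    rw [zero_add, zero_smul, add_zero, e, smul_eq_mul, inv_mul_le_iff₀ ht.1]
    simp only [smul_eq_mul] at h4
    linarith
  have := le_of_tendsto h2 h3
  linarith

theorem nonneg_of_forall_le_add_mul {m K a : ℝ} (h : ∀ t : ℝ, 0 ≤ t → m ≤ K + t * a) : 0 ≤ a := by
  by_contra! ha
  have h1 := h ((|K - m| + 1) / -a) (div_nonneg (by positivity) (by linarith))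
  have h2 : (|K - m| + 1) / -a * a = -(|K - m| + 1) := by
    rw [div_neg, neg_mul, div_mul_cancel₀ _ ha.ne]
  linarith [le_abs_self (K - m)]

theorem inner_add_smul_sub_left {H : Type*} [NormedAddCommGroup H] [InnerProductSpace ℝ H]
    (x y v : H) (t : ℝ) : ⟪x + t • (y - x), v⟫_ℝ = (1 - t) * ⟪x, v⟫_ℝ + t * ⟪y, v⟫_ℝ := by
  rw [inner_add_left, real_inner_smul_left, inner_sub_left]
  ring

namespace SDPData

variable {n : ℕ} {Y W : Type*}
  [NormedAddCommGroup Y] [InnerProductSpace ℝ Y] [FiniteDimensional ℝ Y]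
  [NormedAddCommGroup W] [InnerProductSpace ℝ W] [FiniteDimensional ℝ W]
  {P : SDPData n Y W}

theorem inner_residual (X : SymMat n) (z : DualVar n Y W) :
    ⟪X, P.residual z⟫_ℝ =
      ⟪P.A X, z.fst⟫_ℝ + ⟪P.F X, z.snd.fst⟫_ℝ + ⟪X, z.snd.snd⟫_ℝ - ⟪P.C, X⟫_ℝ := by
  rw [residual, inner_sub_right, inner_add_right, inner_add_right, LinearMap.adjoint_inner_right,
    LinearMap.adjoint_inner_right, real_inner_comm P.C]

/-- The real-valued primal objective, meaningful if `F X ∈ dom h`. -/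
def primalFun (P : SDPData n Y W) (X : SymMat n) : ℝ := (P.h (P.F X)).toReal + ⟪P.C, X⟫_ℝ

theorem coe_primalFun (hP : P.Standing) {X : SymMat n} (hX : P.F X ∈ P.domh) :
    (P.primalFun X : EReal) = P.primalObj X := by
  rw [primalFun, EReal.coe_add, EReal.coe_toReal (ne_of_lt hX) (hP.h_ne_bot _), primalObj]

theorem primalObj_lt_top_iff {X : SymMat n} : P.primalObj X < ⊤ ↔ P.F X ∈ P.domh := by
  rw [primalObj, domh, Set.mem_ofPred_eq, lt_top_iff_ne_top, lt_top_iff_ne_top, not_iff_not]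
  constructor
  · intro h
    by_contra h'
    induction hx : P.h (P.F X) with
    | bot => simp [hx] at h
    | top => exact h' hx
    | coe r =>
      rw [hx, ← EReal.coe_add] at h
      exact EReal.coe_ne_top _ h
  · intro h
    rw [h, EReal.top_add_coe]

/-- A dual point that attains the infimum defining `φ X`. -/
theorem exists_dual_attaining (hP : P.Standing) {X : SymMat n} (hX : P.F X ∈ P.domh) :
    ∃ z ∈ P.dualDom, P.dualFun z + ⟪X, P.residual z⟫_ℝ ≤ -P.primalFun X := by
  have : CompleteSpace W := FiniteDimensional.complete ℝ W
  set f : W → ℝ := fun w => (P.h w).toReal with hf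
  have hd : DifferentiableAt ℝ f (P.F X) :=
    (hP.contDiffOn.differentiableOn one_ne_zero).differentiableAt (hP.dom_open.mem_nhds hX)
  set q : W := (InnerProductSpace.toDual ℝ W).symm (fderiv ℝ f (P.F X)) with hq
  have hq' : ∀ w, ⟪q, w⟫_ℝ = fderiv ℝ f (P.F X) w := fun w => by simp [hq]
  -- With q the gradient of h at F X, the conjugate h* at q is attained at F X, so w = -q gives
  -- equality in Fenchel–Young.
  obtain ⟨z, hz1, hz2, hz3⟩ : ∃ z : DualVar n Y W, z.fst = 0 ∧ z.snd.fst = -q ∧ z.snd.snd = 0 :=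
    ⟨WithLp.toLp 2 (0, WithLp.toLp 2 (-q, 0)), rfl, rfl, rfl⟩
  have hobj : P.dualObj z ≤ ((⟪P.F X, q⟫_ℝ - f (P.F X) : ℝ) : EReal) := by
    refine (dualObj_le_coe_iff hP).2 fun x hx => ?_
    have h1 := hP.strictConvexOn.convexOn.add_fderiv_le hX hx hd
    rw [← hq', inner_sub_right, real_inner_comm x, real_inner_comm (P.F X)] at h1
    rw [hz1, hz2, inner_zero_right, neg_zero, neg_neg, zero_add]
    simp only [hf] at h1 ⊢
    linarith
  have hzD : z ∈ P.dualDom := ⟨⟨hz1 ▸ hP.polyhedral.zero_mem, hz3 ▸ zero_mem_psdCone⟩,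
    hobj.trans_lt (EReal.coe_lt_top _)⟩
  refine ⟨z, hzD, ?_⟩
  rw [← coe_dualFun hP hzD, EReal.coe_le_coe_iff] at hobj
  rw [inner_residual, hz1, hz2, hz3, inner_zero_right, inner_zero_right, inner_neg_right, primalFun]
  simp only [hf] at hobj
  linarith

/-- The upper bound is the attaining dual point. The lower bound adds Fenchel–Young, polarity and
nonnegativity of ⟪X, S⟫. -/
theorem phi_eq_neg_primalFun (hP : P.Standing) {X : SymMat n} (hX : X ∈ P.primalFeasible)
    (hFX : P.F X ∈ P.domh) : P.phi X = ((-P.primalFun X : ℝ) : EReal) := by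
  refine le_antisymm ?_ ((coe_le_phi_iff hP).2 fun z hz => ?_)
  · obtain ⟨z, hz, hle⟩ := exists_dual_attaining hP hFX
    exact (phi_le_coe hP hz X).trans (EReal.coe_le_coe_iff.2 hle)
  · have h1 := (dualObj_le_coe_iff hP).1 (coe_dualFun hP hz).ge _ hFX
    have h2 := hX.2 _ hz.1.1
    have h3 := inner_nonneg_of_mem_psdCone hX.1 hz.1.2
    rw [inner_residual, primalFun]
    rw [inner_sub_left] at h2
    rw [inner_neg_right] at h1
    linarith

/-- Adding d ∈ Q and S ⪰ 0 to a dual point changes the Lagrangian by at most a linear term in (d,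
S). Boundedness below along rays forces that term to be nonnegative. -/
theorem mem_primalFeasible_of_phi_eq (hP : P.Standing) {X : SymMat n} {m : ℝ}
    (hm : P.phi X = m) : X ∈ P.primalFeasible := by
  obtain ⟨z, hz⟩ := dualDom_nonempty (hm ▸ EReal.coe_ne_top m)
  have key : ∀ d ∈ P.Q, ∀ S ∈ psdCone n,
      m ≤ P.dualFun z + ⟪X, P.residual z⟫_ℝ + (⟪P.A X, d⟫_ℝ - ⟪P.b, d⟫_ℝ + ⟪X, S⟫_ℝ) := by
    intro d hd S hS
    obtain ⟨z', hz1, hz2, hz3⟩ : ∃ z' : DualVar n Y W,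
        z'.fst = z.fst + d ∧ z'.snd.fst = z.snd.fst ∧ z'.snd.snd = z.snd.snd + S :=
      ⟨WithLp.toLp 2 (z.fst + d, WithLp.toLp 2 (z.snd.fst, z.snd.snd + S)), rfl, rfl, rfl⟩
    have hobj : P.dualObj z' ≤ ((P.dualFun z - ⟪P.b, d⟫_ℝ : ℝ) : EReal) := by
      refine (dualObj_le_coe_iff hP).2 fun x hx => ?_
      have h1 := (dualObj_le_coe_iff hP).1 (coe_dualFun hP hz).ge _ hx
      rw [hz1, hz2, inner_add_right]
      linarith
    have hz'D : z' ∈ P.dualDom := ⟨⟨hz1 ▸ hP.polyhedral.add_mem hz.1.1 hd,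
      hz3 ▸ add_mem_psdCone hz.1.2 hS⟩, hobj.trans_lt (EReal.coe_lt_top _)⟩
    rw [← coe_dualFun hP hz'D, EReal.coe_le_coe_iff] at hobj
    have h2 := (coe_le_phi_iff hP).1 hm.ge z' hz'D
    rw [inner_residual, hz1, hz2, hz3, inner_add_right, inner_add_right] at h2
    rw [inner_residual]
    linarith
  refine ⟨mem_psdCone_iff.2 fun v => nonneg_of_forall_le_add_mul (m := m)
    (K := P.dualFun z + ⟪X, P.residual z⟫_ℝ) fun t ht => ?_, fun d hd => ?_⟩
  · have h1 := key 0 hP.polyhedral.zero_mem _ (smul_mem_psdCone (outer_mem_psdCone v) ht)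
    have h2 : ⟪X, t • SymMat.outer v⟫_ℝ = t * ⟪X, SymMat.outer v⟫_ℝ :=
      real_inner_smul_right (F := SymMat n) X (SymMat.outer v) t
    rwa [h2, inner_zero_right, inner_zero_right, sub_zero, zero_add] at h1
  · have h1 : 0 ≤ ⟪P.A X, d⟫_ℝ - ⟪P.b, d⟫_ℝ := nonneg_of_forall_le_add_mul (m := m)
        (K := P.dualFun z + ⟪X, P.residual z⟫_ℝ) fun t ht => by
      have h1 := key _ (hP.polyhedral.smul_mem hd ht) 0 zero_mem_psdCone
      rw [inner_zero_right, real_inner_smul_right, real_inner_smul_right, add_zero,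
        ← mul_sub] at h1
      exact h1
    rw [inner_sub_left]
    linarith

theorem le_phi_segment (hP : P.Standing) {X X' : SymMat n} {a b t : ℝ} (ha : (a : EReal) ≤ P.phi X)
    (hb : (b : EReal) ≤ P.phi X') (ht0 : 0 ≤ t) (ht1 : t ≤ 1) :
    (((1 - t) * a + t * b : ℝ) : EReal) ≤ P.phi (X + t • (X' - X)) := by
  refine (coe_le_phi_iff hP).2 fun z hz => ?_
  have h1 := mul_le_mul_of_nonneg_left ((coe_le_phi_iff hP).1 ha z hz) (sub_nonneg.2 ht1)
  have h2 := mul_le_mul_of_nonneg_left ((coe_le_phi_iff hP).1 hb z hz) ht0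
  have h3 := inner_add_smul_sub_left X X' (P.residual z) t
  refine le_trans ?_ (add_le_add_right h3.ge _)
  linarith

theorem segment_mem_primalFeasible {X X' : SymMat n} (hX : X ∈ P.primalFeasible)
    (hX' : X' ∈ P.primalFeasible) {t : ℝ} (ht0 : 0 ≤ t) (ht1 : t ≤ 1) :
    X + t • (X' - X) ∈ P.primalFeasible := by
  refine ⟨?_, fun d hd => ?_⟩
  · have e : X + t • (X' - X) = (1 - t) • X + t • X' := by module
    rw [e]
    exact add_mem_psdCone (smul_mem_psdCone hX.1 (sub_nonneg.2 ht1)) (smul_mem_psdCone hX'.1 ht0)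
  · have e : P.b - P.A (X + t • (X' - X)) = (1 - t) • (P.b - P.A X) + t • (P.b - P.A X') := by
      rw [map_add, map_smul, map_sub]
      module
    rw [e, inner_add_left, real_inner_smul_left, real_inner_smul_left]
    have h1 := mul_nonpos_of_nonneg_of_nonpos (sub_nonneg.2 ht1) (hX.2 d hd)
    have h2 := mul_nonpos_of_nonneg_of_nonpos ht0 (hX'.2 d hd)
    linarith

theorem F_segment (X X' : SymMat n) (t : ℝ) :
    P.F (X + t • (X' - X)) = P.F X + t • (P.F X' - P.F X) := by
  rw [map_add, map_smul, map_sub]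

theorem exists_segment_mem_domh (hP : P.Standing) {X : SymMat n} (X' : SymMat n)
    (hX : P.F X ∈ P.domh) : ∃ t : ℝ, 0 < t ∧ t ≤ 1 ∧ P.F (X + t • (X' - X)) ∈ P.domh := by
  have hc : Continuous fun t : ℝ => P.F X + t • (P.F X' - P.F X) := by fun_prop
  have h1 : ∀ᶠ t : ℝ in 𝓝 0, P.F X + t • (P.F X' - P.F X) ∈ P.domh :=
    hc.continuousAt.eventually_mem (hP.dom_open.mem_nhds (by simpa using hX))
  have h2 : ∀ᶠ t : ℝ in 𝓝[>] 0, P.F X + t • (P.F X' - P.F X) ∈ P.domh :=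
    h1.filter_mono nhdsWithin_le_nhds
  obtain ⟨t, ht, ht'⟩ := (h2.and (Ioc_mem_nhdsGT one_pos)).exists
  exact ⟨t, ht'.1, ht'.2, by rwa [F_segment]⟩

theorem primalFun_le_of_mem_primalSol (hP : P.Standing) {X X' : SymMat n} (hX : X ∈ P.primalSol)
    (hX' : X' ∈ P.primalFeasible) (hF : P.F X' ∈ P.domh) : P.primalFun X ≤ P.primalFun X' := by
  have h := hX.2.2 X' hX'
  rwa [← coe_primalFun hP hF, ← coe_primalFun hP (primalObj_lt_top_iff.1 hX.2.1),
    EReal.coe_le_coe_iff] at h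

/-- F X' may lie outside dom h. A short move from X towards X' stays over the open dom h, where φ is
minus the objective, and concavity carries the comparison on to X'. -/
theorem phi_le_of_mem_primalSol (hP : P.Standing) {X : SymMat n} (hX : X ∈ P.primalSol)
    (X' : SymMat n) : P.phi X' ≤ ((-P.primalFun X : ℝ) : EReal) := by
  have hFX := primalObj_lt_top_iff.1 hX.2.1
  have hphi := phi_eq_neg_primalFun hP hX.1 hFX
  refine EReal.le_coe_of_forall_coe_le fun a ha => ?_
  obtain ⟨z, hz, -⟩ := exists_dual_attaining hP hFX
  have htop : P.phi X' ≠ ⊤ := ((phi_le_coe hP hz X').trans_lt (EReal.coe_lt_top _)).ne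
  have hbot : P.phi X' ≠ ⊥ := fun h => EReal.coe_ne_bot a (le_bot_iff.1 (h ▸ ha))
  have hX' := mem_primalFeasible_of_phi_eq hP (EReal.coe_toReal htop hbot).symm
  obtain ⟨t, ht0, ht1, hFt⟩ := exists_segment_mem_domh hP X' hFX
  have hfeas := segment_mem_primalFeasible hX.1 hX' ht0.le ht1
  have h1 := le_phi_segment hP hphi.ge ha ht0.le ht1
  rw [phi_eq_neg_primalFun hP hfeas hFt, EReal.coe_le_coe_iff] at h1
  have h2 := primalFun_le_of_mem_primalSol hP hX hfeas hFt
  have h3 : t * a ≤ t * -P.primalFun X := by linarith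
  exact le_of_mul_le_mul_left h3 ht0

/-- A maximizer of `φ` cannot lie over the boundary of `dom h` if the primal problem is solvable,
since `h` would be affine on a segment. -/
theorem F_mem_domh_of_phi_eq (hP : P.Standing) {X X' : SymMat n} (hX : X ∈ P.primalSol)
    (hX' : P.phi X' = ((-P.primalFun X : ℝ) : EReal)) : P.F X' ∈ P.domh := by
  by_contra hF
  have hFX := primalObj_lt_top_iff.1 hX.2.1
  have hphi := phi_eq_neg_primalFun hP hX.1 hFX
  have hX'f := mem_primalFeasible_of_phi_eq hP hX'
  obtain ⟨t, ht0, ht1, hFt⟩ := exists_segment_mem_domh hP X' hFX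
  have hne : P.F X ≠ P.F (X + t • (X' - X)) := by
    intro h
    rw [F_segment, left_eq_add, smul_eq_zero, sub_eq_zero] at h
    rcases h with h | h
    · exact ht0.ne' h
    · exact hF (h ▸ hFX)
  have hmid : P.F (X + (t / 2) • (X' - X)) =
      (1 / 2 : ℝ) • P.F X + (1 / 2 : ℝ) • P.F (X + t • (X' - X)) := by
    rw [F_segment, F_segment]
    module
  have hFm : P.F (X + (t / 2) • (X' - X)) ∈ P.domh := by
    rw [hmid]
    exact hP.strictConvexOn.1 hFX hFt (by norm_num) (by norm_num) (by norm_num)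
  have hval : ∀ s : ℝ, 0 ≤ s → s ≤ 1 → P.F (X + s • (X' - X)) ∈ P.domh →
      P.primalFun (X + s • (X' - X)) ≤ P.primalFun X := fun s hs0 hs1 hFs => by
    have h1 := le_phi_segment hP hphi.ge hX'.ge hs0 hs1
    rw [phi_eq_neg_primalFun hP (segment_mem_primalFeasible hX.1 hX'f hs0 hs1) hFs,
      EReal.coe_le_coe_iff] at h1
    linarith
  -- The endpoint over t is no worse than X and the midpoint no better, while strict convexity of h
  -- makes the midpoint strictly better than the average.
  have h1 := hval t ht0.le ht1 hFt
  have h2 := primalFun_le_of_mem_primalSol hP hX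
    (segment_mem_primalFeasible hX.1 hX'f (by linarith : 0 ≤ t / 2) (by linarith)) hFm
  have h3 := hP.strictConvexOn.2 hFX hFt hne (by norm_num : (0 : ℝ) < 1 / 2)
    (by norm_num : (0 : ℝ) < 1 / 2) (by norm_num)
  rw [← hmid] at h3
  have h4 : ∀ s : ℝ, ⟪P.C, X + s • (X' - X)⟫_ℝ = (1 - s) * ⟪P.C, X⟫_ℝ + s * ⟪P.C, X'⟫_ℝ :=
    fun s => by
      rw [← real_inner_comm, ← real_inner_comm P.C X, ← real_inner_comm P.C X']
      exact inner_add_smul_sub_left X X' P.C s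
  unfold primalFun at h1 h2
  rw [h4] at h1 h2
  simp only [smul_eq_mul] at h3
  linarith

theorem mvInv_Tphi_eq_primalSol (hP : P.Standing) (hne : P.primalSol.Nonempty) :
    mvInv P.Tphi 0 = P.primalSol := by
  obtain ⟨Xb, hXb⟩ := hne
  ext X
  rw [mem_mvInv_Tphi_iff]
  constructor
  · rintro ⟨m, hm, hmax⟩
    have hphib := phi_eq_neg_primalFun hP hXb.1 (primalObj_lt_top_iff.1 hXb.2.1)
    have hmeq : P.phi X = ((-P.primalFun Xb : ℝ) : EReal) :=
      le_antisymm (phi_le_of_mem_primalSol hP hXb X) (by rw [hm, ← hphib]; exact hmax Xb)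
    have hF := F_mem_domh_of_phi_eq hP hXb hmeq
    have hfeas := mem_primalFeasible_of_phi_eq hP hm
    have hphi := phi_eq_neg_primalFun hP hfeas hF
    refine ⟨hfeas, primalObj_lt_top_iff.2 hF, fun X' hX' => ?_⟩
    have he : P.primalFun X = P.primalFun Xb := by
      have := EReal.coe_injective (hphi.symm.trans hmeq)
      linarith
    rw [← coe_primalFun hP hF, he, coe_primalFun hP (primalObj_lt_top_iff.1 hXb.2.1)]
    exact hXb.2.2 X' hX'
  · intro hX
    exact ⟨-P.primalFun X, phi_eq_neg_primalFun hP hX.1 (primalObj_lt_top_iff.1 hX.2.1),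
      phi_le_of_mem_primalSol hP hX⟩

end SDPData

/-- Every subsequence has a further one converging to a cluster point, where the distance vanishes.
-/
theorem tendsto_infDist_of_isBounded {E : Type*} [PseudoMetricSpace E] [ProperSpace E] {S : Set E}
    {z : ℕ → E} (hbd : Bornology.IsBounded (Set.range z))
    (hcl : ∀ w, MapClusterPt w atTop z → w ∈ S) :
    Tendsto (fun k => Metric.infDist (z k) S) atTop (𝓝 0) := by
  refine tendsto_of_subseq_tendsto fun σ hσ => ?_
  obtain ⟨w, -, τ, hτ, hw⟩ := tendsto_subseq_of_bounded hbd fun k => Set.mem_range_self (σ k)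
  have hwS : w ∈ S := hcl w
    ((hw.mapClusterPt).of_comp (hσ.comp hτ.tendsto_atTop))
  refine ⟨τ, ?_⟩
  have h1 := ((Metric.continuous_infDist_pt S).tendsto w).comp hw
  rwa [Metric.infDist_zero_of_mem hwS] at h1

namespace SDPData

variable {n : ℕ} {Y W : Type*}
  [NormedAddCommGroup Y] [InnerProductSpace ℝ Y] [FiniteDimensional ℝ Y]
  [NormedAddCommGroup W] [InnerProductSpace ℝ W] [FiniteDimensional ℝ W]
  {P : SDPData n Y W}

/-! ### Rates of convergence -/

section Rates

variable {c : ℕ → ℝ} {cInf : EReal} {z : ℕ → DualVar n Y W} {X : ℕ → SymMat n} {η η' : ℕ → ℝ}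
  {G : ℕ → ℝ} {p : ℕ → SymMat n} {Xinf : SymMat n} {κ : ℝ}

theorem CritB.gap_le (hB : P.CritB c z X η)
    (hstep : ∀ k, P.ProxStep (c k) (X k) (X (k + 1)) (z (k + 1)) (G k) (p k)) (k : ℕ) :
    G k ≤ η k ^ 2 / (2 * c k) * ‖X (k + 1) - X k‖ ^ 2 :=
  ((hstep k).le_iff _).1 (hB.le k)

theorem CritB.norm_le (hB : P.CritB c z X η) (hc : ∀ k, 0 < c k)
    (hstep : ∀ k, P.ProxStep (c k) (X k) (X (k + 1)) (z (k + 1)) (G k) (p k)) (k : ℕ) :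
    ‖X (k + 1) - p k‖ ≤ η k * ‖X (k + 1) - X k‖ := by
  refine (hstep k).norm_le (hc k) (mul_nonneg (hB.nonneg k) (norm_nonneg _)) ?_
  refine (hB.gap_le hstep k).trans (le_of_eq ?_)
  ring

theorem CritB.tendsto_inv (hB : P.CritB c z X η) :
    Tendsto (fun k => (1 - η k)⁻¹) atTop (𝓝 1) := by
  have h := (tendsto_const_nhds (x := (1 : ℝ))).sub hB.summable.tendsto_atTop_zero
  rw [sub_zero] at h
  simpa using h.inv₀ one_ne_zero

theorem tendsto_thetaRate (hB : P.CritB c z X η) (hc : ∀ k, 0 < c k) (hmono : Monotone c)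
    (hlim : Tendsto (fun k => (c k : EReal)) atTop (𝓝 cInf)) (hκ : 0 < κ) :
    Tendsto (fun k => thetaRate κ (c k) (η k)) atTop (𝓝 (thetaLim κ cInf)) := by
  have h1 := ((tendsto_inv_recipLim hc hmono hlim).2 κ hκ).1
  simpa [thetaRate] using
    (h1.add (hB.summable.tendsto_atTop_zero.const_mul 2)).mul hB.tendsto_inv

theorem tendsto_tauRate (hB : P.CritB c z X η) (hc : ∀ k, 0 < c k) (hmono : Monotone c)
    (hlim : Tendsto (fun k => (c k : EReal)) atTop (𝓝 cInf)) :
    Tendsto (fun k => tauRate (c k) (η k)) atTop (𝓝 (recipLim cInf)) := by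
  simpa [tauRate] using (tendsto_inv_recipLim hc hmono hlim).1.mul hB.tendsto_inv

theorem tendsto_tauRate' (hB : P.CritB c z X η) (hc : ∀ k, 0 < c k) (hmono : Monotone c)
    (hlim : Tendsto (fun k => (c k : EReal)) atTop (𝓝 cInf)) (hX : Tendsto X atTop (𝓝 Xinf)) :
    Tendsto (fun k => tauRate' (c k) (η k) (X k) (X (k + 1))) atTop
      (𝓝 (‖Xinf‖ * recipLim cInf)) := by
  have hX1 : Tendsto (fun k => X (k + 1)) atTop (𝓝 Xinf) := hX.comp (tendsto_add_atTop_nat 1)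
  have h1 := ((hB.summable.tendsto_atTop_zero.pow 2).mul (hX1.sub hX).norm).add hX1.norm
  have h2 := ((tendsto_tauRate hB hc hmono hlim).mul (h1.add hX.norm)).div_const 2
  have e : recipLim cInf * (0 ^ 2 * ‖Xinf - Xinf‖ + ‖Xinf‖ + ‖Xinf‖) / 2 =
      ‖Xinf‖ * recipLim cInf := by ring
  rw [e] at h2
  exact h2

theorem tendsto_thetaRate' (hB : P.CritB c z X η) (hB' : P.CritB' c z X η') (hc : ∀ k, 0 < c k)
    (hmono : Monotone c) (hlim : Tendsto (fun k => (c k : EReal)) atTop (𝓝 cInf)) (κl : ℝ) :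
    Tendsto (fun k => thetaRate' κl (c k) (η k) (η' k)) atTop (𝓝 (κl * recipLim cInf)) := by
  have h := (((tendsto_inv_recipLim hc hmono hlim).1.const_mul κl).mul
    (hB'.tendsto.const_add 1)).mul hB.tendsto_inv
  simpa [thetaRate'] using h

theorem norm_residual_le_tauRate (hΩ : (mvInv P.Tphi 0).Nonempty) (hB : P.CritB c z X η)
    (hc : ∀ k, 0 < c k)
    (hR : ∀ k, ‖P.residual (z (k + 1))‖ = (c k)⁻¹ * ‖X (k + 1) - X k‖)
    (hstep : ∀ k, P.ProxStep (c k) (X k) (X (k + 1)) (z (k + 1)) (G k) (p k)) {k : ℕ}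
    (hη : η k < 1) : ‖P.residual (z (k + 1))‖ ≤
      tauRate (c k) (η k) * Metric.infDist (X k) (mvInv P.Tphi 0) := by
  rw [hR, tauRate, mul_assoc]
  exact mul_le_mul_of_nonneg_left ((hstep k).norm_sub_le hΩ hη (hB.norm_le hc hstep k))
    (inv_nonneg.2 (hc k).le)

/-- The linear rates of the multipliers, the dual feasibility and the dual objective value. -/
theorem exists_forall_rates (hP : P.Standing) (hΩ : (mvInv P.Tphi 0).Nonempty)
    (hc : ∀ k, 0 < c k) (hmono : Monotone c)
    (hlim : Tendsto (fun k => (c k : EReal)) atTop (𝓝 cInf))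
    (hR : ∀ k, ‖P.residual (z (k + 1))‖ = (c k)⁻¹ * ‖X (k + 1) - X k‖)
    (hstep : ∀ k, P.ProxStep (c k) (X k) (X (k + 1)) (z (k + 1)) (G k) (p k))
    (hp : Tendsto p atTop (𝓝 Xinf)) (hκ : 0 < κ) (hsub : MetricallySubregular P.Tphi Xinf 0 κ)
    (hB : P.CritB c z X η) :
    ∃ k₀ : ℕ, ∀ k ≥ k₀, η k < 1 ∧ thetaRate κ (c k) (η k) < 1 ∧
      Metric.infDist (X (k + 1)) (mvInv P.Tphi 0) ≤
        thetaRate κ (c k) (η k) * Metric.infDist (X k) (mvInv P.Tphi 0) ∧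
      ‖P.residual (z (k + 1))‖ ≤
        tauRate (c k) (η k) * Metric.infDist (X k) (mvInv P.Tphi 0) ∧
      P.dualObj (z (k + 1)) - P.dualVal ≤
        ((tauRate' (c k) (η k) (X k) (X (k + 1)) *
          Metric.infDist (X k) (mvInv P.Tphi 0) : ℝ) : EReal) := by
  obtain ⟨-, U, hU, hsub⟩ := hsub
  refine eventually_atTop.1 ?_
  -- Subregularity is used at the exact proximal points, which also converge to Xinf and so enter U.
  filter_upwards [hB.summable.tendsto_atTop_zero.eventually_lt_const one_pos,
    (tendsto_thetaRate hB hc hmono hlim hκ).eventually_lt_const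
      ((tendsto_inv_recipLim hc hmono hlim).2 κ hκ).2, hp hU] with k h1 h2 h3
  have hn := hB.norm_le hc hstep k
  exact ⟨h1, h2, (hstep k).infDist_le_thetaRate (hc k) hΩ hκ (hB.nonneg k) h1 hn (hsub _ h3),
    norm_residual_le_tauRate hΩ hB hc hR hstep h1,
    (hstep k).dualObj_sub_le_tauRate hP (hc k) hΩ h1 hn (hB.gap_le hstep k)⟩

theorem qSuperlinear_infDist (hB : P.CritB c z X η) (hc : ∀ k, 0 < c k) (hmono : Monotone c)
    (hlim : Tendsto (fun k => (c k : EReal)) atTop (𝓝 ⊤)) (hX : Tendsto X atTop (𝓝 Xinf))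
    (hXinf : Xinf ∈ mvInv P.Tphi 0) (hκ : 0 < κ)
    (h : ∀ᶠ k in atTop, Metric.infDist (X (k + 1)) (mvInv P.Tphi 0) ≤
      thetaRate κ (c k) (η k) * Metric.infDist (X k) (mvInv P.Tphi 0)) :
    QSuperlinear fun k => Metric.infDist (X k) (mvInv P.Tphi 0) := by
  refine ⟨fun k => Metric.infDist_nonneg, ?_, _, ?_, h⟩
  · have h1 := ((Metric.continuous_infDist_pt (mvInv P.Tphi 0)).tendsto Xinf).comp hX
    rwa [Metric.infDist_zero_of_mem hXinf] at h1
  · simpa [thetaLim] using tendsto_thetaRate hB hc hmono hlim hκ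

/-- The linear rate of the dual variables. -/
theorem exists_forall_dual_rate (hP : P.Standing) (hΩ : (mvInv P.Tphi 0).Nonempty)
    (hc : ∀ k, 0 < c k) (hXz : ∀ k, X (k + 1) = X k + c k • P.residual (z (k + 1)))
    (hR : ∀ k, ‖P.residual (z (k + 1))‖ = (c k)⁻¹ * ‖X (k + 1) - X k‖)
    (hstep : ∀ k, P.ProxStep (c k) (X k) (X (k + 1)) (z (k + 1)) (G k) (p k))
    (hX : Tendsto X atTop (𝓝 Xinf)) (hB : P.CritB c z X η) (hB' : P.CritB' c z X η')
    (hψ : (mvInv P.Tpsi 0).Nonempty)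
    (hz : Tendsto (fun k => Metric.infDist (z k) (mvInv P.Tpsi 0)) atTop (𝓝 0))
    {κl δ : ℝ} (hκl : 0 ≤ κl) (hδ : 0 < δ)
    (hl : ∀ p : WithLp 2 (DualVar n Y W × SymMat n),
      Metric.infDist p {q | q.fst ∈ mvInv P.Tpsi 0 ∧ q.snd = Xinf} ≤ δ →
      (P.Tl p).Nonempty →
      Metric.infEDist p (mvInv P.Tl 0) ≤ ENNReal.ofReal κl * Metric.infEDist 0 (P.Tl p)) :
    ∃ k₁ : ℕ, ∀ k ≥ k₁, η k < 1 ∧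
      Metric.infDist (z (k + 1)) (mvInv P.Tpsi 0) ≤
        thetaRate' κl (c k) (η k) (η' k) * Metric.infDist (X k) (mvInv P.Tphi 0) := by
  have hnear : Tendsto (fun k => Metric.infDist (z (k + 1)) (mvInv P.Tpsi 0) +
      dist (X (k + 1)) Xinf) atTop (𝓝 0) := by
    have := (hz.add (tendsto_iff_dist_tendsto_zero.1 hX)).comp (tendsto_add_atTop_nat 1)
    simpa [Function.comp_def] using this
  refine eventually_atTop.1 ?_
  filter_upwards [hB.summable.tendsto_atTop_zero.eventually_lt_const one_pos,
    hnear.eventually_le_const hδ] with k h1 h2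
  refine ⟨h1, ?_⟩
  have he : 0 ≤ η' k / c k * ‖X (k + 1) - X k‖ :=
    mul_nonneg (div_nonneg (hB'.nonneg k) (hc k).le) (norm_nonneg _)
  obtain ⟨hne, hle⟩ := infEDist_Tl_le hP (hstep k).mem (hXz k) he (hB'.le k)
  have h3 := hl _ ((WithLp.infDist_prod_singleton_le hψ Xinf
    (WithLp.toLp 2 (z (k + 1), X (k + 1)))).trans h2) hne
  have h4 : Metric.infEDist (z (k + 1)) (mvInv P.Tpsi 0) ≤ ENNReal.ofReal
      (κl * (η' k / c k * ‖X (k + 1) - X k‖ + ‖P.residual (z (k + 1))‖)) := by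
    refine (WithLp.infEDist_fst_le (fun q hq => fst_mem_of_mem_mvInv_Tl hq)
      (WithLp.toLp 2 (z (k + 1), X (k + 1)))).trans (h3.trans ?_)
    rw [ENNReal.ofReal_mul hκl]
    gcongr
  refine (ENNReal.toReal_le_of_le_ofReal
    (mul_nonneg hκl (add_nonneg he (norm_nonneg _))) h4).trans ?_
  have h5 := (hstep k).norm_sub_le hΩ h1 (hB.norm_le hc hstep k)
  have h6 : 0 ≤ κl * (c k)⁻¹ * (1 + η' k) :=
    mul_nonneg (mul_nonneg hκl (inv_nonneg.2 (hc k).le)) (by linarith [hB'.nonneg k])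
  have h7 := mul_le_mul_of_nonneg_left h5 h6
  rw [hR]
  unfold thetaRate'
  have h8 : κl * (η' k / c k * ‖X (k + 1) - X k‖ + (c k)⁻¹ * ‖X (k + 1) - X k‖) =
      κl * (c k)⁻¹ * (1 + η' k) * ‖X (k + 1) - X k‖ := by
    rw [div_eq_mul_inv]
    ring
  rw [h8]
  linarith

end Rates

end SDPData

end

/-! ### Assembly of the theorem -/

theorem mainTheorem1 {n : ℕ} {Y W : Type*}
    [NormedAddCommGroup Y] [InnerProductSpace ℝ Y] [FiniteDimensional ℝ Y]
    [NormedAddCommGroup W] [InnerProductSpace ℝ W] [FiniteDimensional ℝ W]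
    (P : SDPData n Y W) (hP : P.Standing) :
    -- `T_φ⁻¹(0)` is the optimal solution set of the primal problem
    (P.primalSol.Nonempty → mvInv P.Tphi 0 = P.primalSol) ∧
    ∀ (c : ℕ → ℝ) (cInf : EReal) (z : ℕ → DualVar n Y W) (X : ℕ → SymMat n) (ε : ℕ → ℝ),
      (mvInv P.Tphi 0).Nonempty →
      (∀ k, 0 < c k) → Monotone c →
      Tendsto (fun k => (c k : EReal)) atTop (𝓝 cInf) →
      P.IsALM c z X → P.CritA c z X ε →
      -- convergence
      Bornology.IsBounded (Set.range X) ∧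
      (∀ k, z (k + 1) ∈ P.dualSet) ∧
      (∀ k, ‖P.residual (z (k + 1))‖ = (c k)⁻¹ * ‖X (k + 1) - X k‖) ∧
      Tendsto (fun k => ‖P.residual (z (k + 1))‖) atTop (𝓝 0) ∧
      (∀ k, P.dualObj (z (k + 1)) - P.dualVal ≤
        P.zeta c X k (z (k + 1)) - P.infZeta c X k +
          ((1 / (2 * c k) * (‖X k‖ ^ 2 - ‖X (k + 1)‖ ^ 2) : ℝ) : EReal)) ∧
      (P.dualSol.Nonempty → Bornology.IsBounded P.dualSol →
        Bornology.IsBounded (Set.range z) ∧ ∀ z', MapClusterPt z' atTop z → z' ∈ P.dualSol) ∧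
      ∃ Xinf ∈ mvInv P.Tphi 0, Tendsto X atTop (𝓝 Xinf) ∧
        ∀ (κφ : ℝ) (η : ℕ → ℝ), 0 < κφ → MetricallySubregular P.Tphi Xinf 0 κφ →
          P.CritB c z X η →
          -- part (a)
          ((∃ k₀ : ℕ, ∀ k ≥ k₀, η k < 1 ∧ thetaRate κφ (c k) (η k) < 1 ∧
              Metric.infDist (X (k + 1)) (mvInv P.Tphi 0) ≤
                thetaRate κφ (c k) (η k) * Metric.infDist (X k) (mvInv P.Tphi 0) ∧
              ‖P.residual (z (k + 1))‖ ≤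
                tauRate (c k) (η k) * Metric.infDist (X k) (mvInv P.Tphi 0) ∧
              P.dualObj (z (k + 1)) - P.dualVal ≤
                ((tauRate' (c k) (η k) (X k) (X (k + 1)) *
                  Metric.infDist (X k) (mvInv P.Tphi 0) : ℝ) : EReal)) ∧
            Tendsto (fun k => thetaRate κφ (c k) (η k)) atTop (𝓝 (thetaLim κφ cInf)) ∧
            Tendsto (fun k => tauRate (c k) (η k)) atTop (𝓝 (recipLim cInf)) ∧
            Tendsto (fun k => tauRate' (c k) (η k) (X k) (X (k + 1))) atTop
              (𝓝 (‖Xinf‖ * recipLim cInf)) ∧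
            (cInf = ⊤ →
              QSuperlinear (fun k => Metric.infDist (X k) (mvInv P.Tphi 0)) ∧
              RSuperlinear (fun k => ((‖P.residual (z k)‖ : ℝ) : EReal)) ∧
              RSuperlinear (fun k => P.dualObj (z k) - P.dualVal))) ∧
          -- part (b)
          (∀ (η' : ℕ → ℝ) (κl δ : ℝ), P.CritB' c z X η' →
            (mvInv P.Tpsi 0).Nonempty → Bornology.IsBounded (mvInv P.Tpsi 0) →
            0 ≤ κl → 0 < δ →
            (∀ p : WithLp 2 (DualVar n Y W × SymMat n),
              Metric.infDist p {q | q.fst ∈ mvInv P.Tpsi 0 ∧ q.snd = Xinf} ≤ δ →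
              (P.Tl p).Nonempty →
              Metric.infEDist p (mvInv P.Tl 0) ≤
                ENNReal.ofReal κl * Metric.infEDist 0 (P.Tl p)) →
            (∃ k₁ : ℕ, ∀ k ≥ k₁, η k < 1 ∧
              Metric.infDist (z (k + 1)) (mvInv P.Tpsi 0) ≤
                thetaRate' κl (c k) (η k) (η' k) * Metric.infDist (X k) (mvInv P.Tphi 0)) ∧
            Tendsto (fun k => thetaRate' κl (c k) (η k) (η' k)) atTop
              (𝓝 (κl * recipLim cInf)) ∧
            (cInf = ⊤ →
              RSuperlinear (fun k =>
                ((Metric.infDist (z k) (mvInv P.Tpsi 0) : ℝ) : EReal)))) := by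
  refine ⟨SDPData.mvInv_Tphi_eq_primalSol hP, ?_⟩
  intro c cInf z X ε hΩ hc hmono hlim hALM hA
  obtain ⟨G, p, hstep⟩ := SDPData.exists_proxSteps hP hΩ hc hALM hA
  have hG : ∀ k, G k ≤ ε k ^ 2 / (2 * c k) := fun k => ((hstep k).le_iff _).1 (hA.le k)
  obtain ⟨hpX, Xinf, hXinf, hX⟩ := SDPData.exists_tendsto_of_proxSteps hP hΩ hc hmono hlim
    hA.nonneg hA.summable hstep hG
  have hp : Tendsto p atTop (𝓝 Xinf) := by simpa using hpX.add hX
  have hX1 : Tendsto (fun k => X (k + 1)) atTop (𝓝 Xinf) := hX.comp (tendsto_add_atTop_nat 1)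
  have hR : ∀ k, ‖P.residual (z (k + 1))‖ = (c k)⁻¹ * ‖X (k + 1) - X k‖ := fun k => by
    rw [hALM.X_eq k]
    exact norm_eq_inv_mul_norm_add_smul_sub (hc k) _ _
  have hRlim : Tendsto (fun k => ‖P.residual (z (k + 1))‖) atTop (𝓝 0) := by
    simp only [hR]
    simpa using (tendsto_inv_recipLim hc hmono hlim).1.mul (hX1.sub hX).norm
  have hdual : P.dualSol.Nonempty → Bornology.IsBounded P.dualSol →
      Bornology.IsBounded (Set.range z) ∧ ∀ z', MapClusterPt z' atTop z → z' ∈ P.dualSol := by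
    intro hne hbd
    have hgap := SDPData.tendsto_gap hc hmono hlim hA.summable hstep hG hX
    -- The point z k comes from step k - 1; the arbitrary z 0 is avoided by asking for the bound
    -- only from k = 1.
    refine SDPData.isBounded_and_mem_dualSol hP hne hbd
      (b := fun k => G (k - 1) + 1 / (2 * c (k - 1)) * (‖X (k - 1)‖ ^ 2 - ‖X k‖ ^ 2)) ?_ ?_ ?_
    · refine eventually_atTop.2 ⟨1, fun k hk => ?_⟩
      obtain ⟨j, rfl⟩ : ∃ j, k = j + 1 := ⟨k - 1, by omega⟩
      refine ⟨(hstep j).mem, le_trans (EReal.coe_le_coe_iff.2 ?_) (hstep j).le_dualVal⟩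
      simp only [Nat.add_sub_cancel]
      linarith
    · rw [← tendsto_add_atTop_iff_nat 1]
      simpa only [Nat.add_sub_cancel] using hgap
    · rw [← tendsto_add_atTop_iff_nat 1, tendsto_zero_iff_norm_tendsto_zero]
      exact hRlim
  refine ⟨Metric.isBounded_range_of_tendsto X hX, fun k => (hstep k).mem.1, hR, hRlim, fun k => ?_,
    hdual, Xinf, hXinf, hX, ?_⟩
  · have h1 := (hstep k).dualObj_sub_le hP
    rw [EReal.coe_add, ← (hstep k).sub_eq] at h1
    exact h1
  intro κφ η hκ hsub hB
  obtain ⟨k₀, hk₀⟩ := SDPData.exists_forall_rates hP hΩ hc hmono hlim hR hstep hp hκ hsub hB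
  have hev : ∀ᶠ k in atTop, k₀ ≤ k := eventually_ge_atTop k₀
  have hτ := SDPData.tendsto_tauRate hB hc hmono hlim
  have hτ' := SDPData.tendsto_tauRate' hB hc hmono hlim hX
  have hQ : cInf = ⊤ → QSuperlinear fun k => Metric.infDist (X k) (mvInv P.Tphi 0) := fun htop =>
    SDPData.qSuperlinear_infDist hB hc hmono (htop ▸ hlim) hX hXinf hκ
      (hev.mono fun k hk => (hk₀ k hk).2.2.1)
  refine ⟨⟨⟨k₀, hk₀⟩, SDPData.tendsto_thetaRate hB hc hmono hlim hκ, hτ, hτ', fun htop =>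
    ⟨hQ htop, ?_, ?_⟩⟩, ?_⟩
  · exact rSuperlinear_of_succ_le (hQ htop) hτ
      (hev.mono fun k hk => EReal.coe_le_coe_iff.2 (hk₀ k hk).2.2.2.1)
  · exact rSuperlinear_of_succ_le (hQ htop) hτ' (hev.mono fun k hk => (hk₀ k hk).2.2.2.2)
  intro η' κl δ hB' hψ hψbd hκl hδ hl
  -- The zeros of T_ψ are the dual solutions, so the iterates are bounded and approach them; this
  -- brings them into the region of the error bound on T_l.
  have hz : Tendsto (fun k => Metric.infDist (z k) (mvInv P.Tpsi 0)) atTop (𝓝 0) := by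
    have : ProperSpace (DualVar n Y W) := SDPData.dualVar_properSpace
    rw [SDPData.mvInv_Tpsi hP] at hψ hψbd ⊢
    obtain ⟨h1, h2⟩ := hdual hψ hψbd
    exact tendsto_infDist_of_isBounded h1 h2
  obtain ⟨k₁, hk₁⟩ := SDPData.exists_forall_dual_rate hP hΩ hc hALM.X_eq hR hstep hX hB hB' hψ hz
    hκl hδ hl
  have hθ' := SDPData.tendsto_thetaRate' hB hB' hc hmono hlim κl
  exact ⟨⟨k₁, hk₁⟩, hθ', fun htop => rSuperlinear_of_succ_le (hQ htop) hθ'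
    ((eventually_ge_atTop k₁).mono fun k hk => EReal.coe_le_coe_iff.2 (hk₁ k hk).2)⟩
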